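/- Let $\Omega\subset\mathbb R^2$ satisfy: (i) $\Omega$ is non-empty, convex and closed, $0\notin\Omega$, and $\lambda\Omega\subset\Omega$ for all $\lambda>1$; $(*)$ $\lambda\Omega\cap\partial\Omega=\varnothing$ for all $\lambda>1$; $(**)$ the cone $C=\overline{\mathbb R_+\Omega}$, $\mathbb R_+=[0,\infty)$, has boundary $\partial C=l_0\cup l_1$ with two rays $l_0,l_1$ issued from the origin, and $\operatorname{dist}(l_0,\Omega)=\operatorname{dist}(l_1,\Omega)=0$. Let $\nu$ be the anti-norm with unit ball $\Omega$, that is, $\nu(\xi)=\limsup_{\zeta\to\xi}\sup\{\lambda>0:\zeta\in\lambda\Omega\}$ with $\sup\varnothing=-\infty$. On $\mathrm{Aff}_+\mathbb R=\{(a,b): b>0\}$ (the maps $x\mapsto a+bx$) consider the problem $\int_0^T\nu(u)\,dt\to\max$ over Lipschitz curves with $\dot a=bu_1$, $\dot b=bu_2$, $u=(u_1,u_2)\in C$, with fixed end points and free $T>0$. An *extremal* is a triple $(q,p,u)$ on $[0,T]$, $q=(a,b)$, with $u\ne0$ almost everywhere, that satisfies the Pontryagin maximum principle: $p=(p_1,p_2)$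 is Lipschitz, $\lambda_0\in\{0,-1\}$, $(\lambda_0,p(t))\neq0$ for all $t$, and for a.e. $t$, with $\mathcal H=b(p_1u_1+p_2u_2)-\lambda_0\nu(u)$, one has $\dot q=\mathcal H_p$, $\dot p=-\mathcal H_q$, and $u(t)$ maximises $\mathcal H(q(t),p(t),\cdot)$ over $C$. It is *normal* if $\lambda_0=-1$, *abnormal* if $\lambda_0=0$, *timelike* if $u\in\mathbb R_+\Omega$ a.e., *lightlike* if $\nu(u)=0$ a.e. Put $h=(h_1,h_2)=b\,(p_1,p_2)$. A *face* of $\Omega$ is its non-empty intersection with a supporting line; the extremal is *singular* along a face $F$ with $\dim F\ge1$ on a measurable set $\mathbb T\subset[0,T]$ of positive measure if $\operatorname{argmax}_{v\in\Omega}\langle h(t),v\rangle=F$ for a.e. $t\in\mathbb T$. Let $\Omega^\diamond=\{(x,y): xv_1-yv_2\ge1\ \ \forall (v_1,v_2)\in\Omega\}$ be the antipolar set, and fix any $\omega_0\in\partial\Omega^\diamond$. For $\omega\in\partial\Omega^\diamond$ let $\eta$ be twice the signed area (positive counterclockwise) of the sector bounded by the segments $O\omega_0$, $O\omega$ and the arc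 of $\partial\Omega^\diamond$ from $\omega_0$ to $\omega$; then $(\cosh_{\Omega^\diamond}\eta,\sinh_{\Omega^\diamond}\eta):=\omega$. **Theorem.** Every extremal is either normal timelike or abnormal lightlike, and not both. (1) For every timelike extremal in natural parametrisation ($\nu(u)=1$ a.e.) at least one of the following holds. (i.a) The extremal is not singular along any face of $\Omega$ on any set of positive measure, and there are constants $c_1\ne0$, $c_2$ and a function $\eta(t)$ such that for all $t\in[0,T]$ $$a=c_1\sinh_{\Omega^\diamond}\eta+c_2,\qquad b=c_1\cosh_{\Omega^\diamond}\eta,\qquad (h_1,h_2)=(-\cosh_{\Omega^\diamond}\eta,\ \sinh_{\Omega^\diamond}\eta),$$ where $\cosh_{\Omega^\diamond}\eta(t)\neq0$ and $\dot\eta=\cosh_{\Omega^\diamond}\eta$, that is, $t=\int_{\eta(0)}^{\eta(t)}\frac{d\eta}{\cosh_{\Omega^\diamond}\eta}$. (i.b) $h_1\equiv0$, and there is a face $F$ (a point or a larger face) with a horizontal supporting line such that $u(t)\in F$ for a.e. $t$ and $\operatorname{argmax}_{v\in\Omega}\langle h(t),v\rangle=F$ for every $t\in[0,T]$; in particular the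 extremal is singular along $F$ on $[0,T]$ if $\dim F>0$. Moreover, whenever $u(t)\in F$ for a.e. $t$, where $F$ is a face with a horizontal supporting line, there are constants $c_3>0$ and $c_4$ with $b(t)=c_3e^{c_4t}$ for all $t\in[0,T]$, and $c_4$ is the second coordinate of all points of $F$. There is at most one such face $F$. (2) Every lightlike extremal is abnormal, its control belongs a.e. to one and the same boundary ray $l\in\{l_0,l_1\}$, the curve satisfies $q(t)-q(0)\in l$ for all $t$, and its length $\int_0^T\nu(u)\,dt$ is zero. There are exactly two lightlike trajectories issuing from the identity $(0,1)$, namely those parallel to $l_0$ and $l_1$: the images of lightlike extremals with $q(0)=(0,1)$ are exactly the segments from $(0,1)$ to a point $P\ne(0,1)$ of $((0,1)+l_0)\cup((0,1)+l_1)$ with $b>0$. Here $l_0\neq l_1$, and the two trajectories have only $(0,1)$ in common. -/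

import Mathlib

open Set Filter Topology MeasureTheory
open scoped Pointwise

namespace LorentzAff

noncomputable section

/-! ### Unit balls, cones and anti-norms in the plane

The plane is `ℝ × ℝ`.  Its topology, its Lebesgue measure, the class of Lipschitz curves and the
relation "two sets are at distance zero" are the Euclidean ones. -/

/-- The pairing of a covector `h = (h₁, h₂)` with a vector `u = (u₁, u₂)`. -/
def pair (h u : ℝ × ℝ) : ℝ := h.1 * u.1 + h.2 * u.2

/-- Property (i): non-empty, convex, closed, not containing the origin, with the ray property. -/
structure PropI (Ω : Set (ℝ × ℝ)) : Prop where
  nonempty : Ω.Nonempty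
  convex : Convex ℝ Ω
  closed : IsClosed Ω
  zero_notMem : (0 : ℝ × ℝ) ∉ Ω
  ray : ∀ c : ℝ, 1 < c → c • Ω ⊆ Ω

/-- Property (*): no ray issued from the origin lies on the boundary of `Ω`. -/
def PropStar (Ω : Set (ℝ × ℝ)) : Prop :=
  ∀ c : ℝ, 1 < c → (c • Ω) ∩ frontier Ω = ∅

/-- `ℝ₊ Ω`, where `ℝ₊ = [0, ∞)`. -/
def rayHull (Ω : Set (ℝ × ℝ)) : Set (ℝ × ℝ) := (Ici (0 : ℝ)) • Ω

/-- The closed cone `C = cl (ℝ₊ Ω)`. -/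
def cone (Ω : Set (ℝ × ℝ)) : Set (ℝ × ℝ) := closure (rayHull Ω)

/-- A closed ray issued from the origin. -/
def IsRay (l : Set (ℝ × ℝ)) : Prop :=
  ∃ v : ℝ × ℝ, v ≠ 0 ∧ l = {w | ∃ s : ℝ, 0 ≤ s ∧ w = s • v}

/-- Property (**): the boundary of the cone `C` consists of the two rays `l₀`, `l₁`, and both are
at distance zero from `Ω`. -/
structure PropStarStar (Ω l₀ l₁ : Set (ℝ × ℝ)) : Prop where
  ray₀ : IsRay l₀
  ray₁ : IsRay l₁
  frontier_cone : frontier (cone Ω) = l₀ ∪ l₁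
  dist₀ : ⨅ x ∈ l₀, Metric.infEDist x Ω = 0
  dist₁ : ⨅ x ∈ l₁, Metric.infEDist x Ω = 0

/-- The auxiliary functional `sup {c > 0 | ξ ∈ c Ω}`, with `sup ∅ = -∞`. -/
def preNorm (Ω : Set (ℝ × ℝ)) (ξ : ℝ × ℝ) : EReal :=
  sSup {x : EReal | ∃ c : ℝ, 0 < c ∧ ξ ∈ c • Ω ∧ x = (c : EReal)}

/-- The anti-norm with unit ball `Ω`: the closure (upper semicontinuous hull) of `preNorm Ω`. -/
def antiNorm (Ω : Set (ℝ × ℝ)) (ξ : ℝ × ℝ) : EReal :=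
  limsup (preNorm Ω) (𝓝 ξ)

/-- The anti-norm as a real number; used only on its domain `C`, where it is finite. -/
def nu (Ω : Set (ℝ × ℝ)) (ξ : ℝ × ℝ) : ℝ := (antiNorm Ω ξ).toReal

/-! ### The antipolar set and the functions `cosh_Ω`, `sinh_Ω` -/

/-- The antipolar set of `Ω`. -/
def antipolar (Ω : Set (ℝ × ℝ)) : Set (ℝ × ℝ) :=
  {π | ∀ ω ∈ Ω, 1 ≤ π.1 * ω.1 - π.2 * ω.2}

/-- The sector bounded by the segments from the origin to `ω₀` and to `ω` and by the arc of the
boundary of `Ω` between `ω₀` and `ω`: the part of the convex cone spanned by `ω₀` and `ω` that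
`Ω` cuts off at the origin. -/
def sector (Ω : Set (ℝ × ℝ)) (ω₀ ω : ℝ × ℝ) : Set (ℝ × ℝ) :=
  {z | ∃ s r : ℝ, 0 ≤ s ∧ 0 ≤ r ∧ z = s • ω₀ + r • ω} \ Ω

/-- The "angle" of `ω`: twice the area of the sector, counted with a plus sign
counterclockwise from `ω₀` and with a minus sign clockwise. -/
def angle (Ω : Set (ℝ × ℝ)) (ω₀ ω : ℝ × ℝ) : ℝ :=
  Real.sign (ω₀.1 * ω.2 - ω₀.2 * ω.1) * (2 * (volume (sector Ω ω₀ ω)).toReal)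

/-- The angles at which `cosh_Ω` and `sinh_Ω` are defined. -/
def angleDomain (Ω : Set (ℝ × ℝ)) (ω₀ : ℝ × ℝ) : Set ℝ := angle Ω ω₀ '' frontier Ω

/-- The boundary point of `Ω` with a given angle (a junk value outside of `angleDomain`). -/
def boundaryPoint (Ω : Set (ℝ × ℝ)) (ω₀ : ℝ × ℝ) : ℝ → ℝ × ℝ :=
  Function.invFunOn (angle Ω ω₀) (frontier Ω)

/-- `cosh_Ω`, with base point `ω₀ ∈ ∂Ω`. -/
def coshO (Ω : Set (ℝ × ℝ)) (ω₀ : ℝ × ℝ) (θ : ℝ) : ℝ := (boundaryPoint Ω ω₀ θ).1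

/-- `sinh_Ω`, with base point `ω₀ ∈ ∂Ω`. -/
def sinhO (Ω : Set (ℝ × ℝ)) (ω₀ : ℝ × ℝ) (θ : ℝ) : ℝ := (boundaryPoint Ω ω₀ θ).2

/-! ### The group of orientation preserving affine maps of the line

The pair `(a, b)` with `b > 0` stands for the map `x ↦ a + b x`. -/

/-- The group law (composition of affine maps). -/
def affMul (g k : ℝ × ℝ) : ℝ × ℝ := (g.1 + g.2 * k.1, g.2 * k.2)

/-- The unit element. -/
def affOne : ℝ × ℝ := (0, 1)

/-- The differential of the left translation by `g`. -/
def dL (g u : ℝ × ℝ) : ℝ × ℝ := (g.2 * u.1, g.2 * u.2)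

/-- `dL g` is indeed the differential of `affMul g` at the unit element. -/
theorem hasDerivAt_affMul (g u : ℝ × ℝ) :
    HasDerivAt (fun s : ℝ => affMul g (affOne + s • u)) (dL g u) 0 := by
  have h1 : HasDerivAt (fun s : ℝ => g.1 + g.2 * (0 + s * u.1)) (g.2 * u.1) 0 := by
    simpa using ((((hasDerivAt_id (0 : ℝ)).mul_const u.1).const_add 0).const_mul g.2).const_add g.1
  have h2 : HasDerivAt (fun s : ℝ => g.2 * (1 + s * u.2)) (g.2 * u.2) 0 := by
    simpa using (((hasDerivAt_id (0 : ℝ)).mul_const u.2).const_add 1).const_mul g.2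
  exact h1.prodMk h2

/-! ### Extremals of the Pontryagin maximum principle -/

/-- The Pontryagin function `⟨p, dL_q u⟩ - λ₀ ν(u)` of the problem of maximising `∫ ν(u) dt`
subject to `q' = dL_q u`, `u ∈ C`. -/
def pontryagin (Ω : Set (ℝ × ℝ)) (lam : ℝ) (q p u : ℝ × ℝ) : ℝ :=
  pair p (dL q u) - lam * nu Ω u

/-- The partial gradient of the Pontryagin function with respect to `q`. -/
def gradQ (Ω : Set (ℝ × ℝ)) (lam : ℝ) (q p u : ℝ × ℝ) : ℝ × ℝ :=
  (deriv (fun x => pontryagin Ω lam (x, q.2) p u) q.1,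
   deriv (fun y => pontryagin Ω lam (q.1, y) p u) q.2)

/-- The partial gradient of the Pontryagin function with respect to `p`. -/
def gradP (Ω : Set (ℝ × ℝ)) (lam : ℝ) (q p u : ℝ × ℝ) : ℝ × ℝ :=
  (deriv (fun x => pontryagin Ω lam q (x, p.2) u) p.1,
   deriv (fun y => pontryagin Ω lam q (p.1, y) u) p.2)

/-- `(q, p, u)` is an extremal on `[0, T]` with multiplier `λ₀ = lam ∈ {0, -1}`.  As usual, the
intervals of rest are excised from the curve, so that `u ≠ 0` almost everywhere. -/
structure IsExtremal (Ω : Set (ℝ × ℝ)) (lam T : ℝ) (q p u : ℝ → ℝ × ℝ) : Prop where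
  T_pos : 0 < T
  lam_mem : lam = 0 ∨ lam = -1
  q_lipschitz : ∃ K : NNReal, LipschitzOnWith K q (Icc 0 T)
  p_lipschitz : ∃ K : NNReal, LipschitzOnWith K p (Icc 0 T)
  q_mem : ∀ t ∈ Icc 0 T, 0 < (q t).2
  u_measurable : AEMeasurable u (volume.restrict (Icc 0 T))
  u_mem : ∀ᵐ t ∂volume.restrict (Icc 0 T), u t ∈ cone Ω
  u_ne_zero : ∀ᵐ t ∂volume.restrict (Icc 0 T), u t ≠ 0
  nontrivial : ∀ t ∈ Icc 0 T, (lam, p t) ≠ 0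
  q_eq : ∀ᵐ t ∂volume.restrict (Icc 0 T), HasDerivAt q (gradP Ω lam (q t) (p t) (u t)) t
  p_eq : ∀ᵐ t ∂volume.restrict (Icc 0 T), HasDerivAt p (-gradQ Ω lam (q t) (p t) (u t)) t
  maximum : ∀ᵐ t ∂volume.restrict (Icc 0 T), ∀ v ∈ cone Ω,
    pontryagin Ω lam (q t) (p t) v ≤ pontryagin Ω lam (q t) (p t) (u t)

/-- The covector `p` translated to the unit element, `h = dL_q^* p`. -/
def momentum (q p : ℝ × ℝ) : ℝ × ℝ := (q.2 * p.1, q.2 * p.2)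

/-- Timelike: the control lies in `ℝ₊ Ω` almost everywhere. -/
def IsTimelike (Ω : Set (ℝ × ℝ)) (T : ℝ) (u : ℝ → ℝ × ℝ) : Prop :=
  ∀ᵐ t ∂volume.restrict (Icc 0 T), u t ∈ rayHull Ω

/-- Lightlike: the anti-norm of the control is zero almost everywhere. -/
def IsLightlike (Ω : Set (ℝ × ℝ)) (T : ℝ) (u : ℝ → ℝ × ℝ) : Prop :=
  ∀ᵐ t ∂volume.restrict (Icc 0 T), antiNorm Ω (u t) = 0

/-- Natural parametrisation of a timelike curve: the anti-norm of the control is one. -/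
def IsNatural (Ω : Set (ℝ × ℝ)) (T : ℝ) (u : ℝ → ℝ × ℝ) : Prop :=
  ∀ᵐ t ∂volume.restrict (Icc 0 T), antiNorm Ω (u t) = 1

/-! ### Faces and singular extremals -/

/-- The set of points of `Ω` at which the linear functional `m` is maximal on `Ω`. -/
def argmaxSet (Ω : Set (ℝ × ℝ)) (m : ℝ × ℝ) : Set (ℝ × ℝ) :=
  {u | u ∈ Ω ∧ ∀ v ∈ Ω, pair m v ≤ pair m u}

/-- A face: the (non-empty) intersection of `Ω` with a supporting line. -/
def IsFace (Ω F : Set (ℝ × ℝ)) : Prop :=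
  F.Nonempty ∧ ∃ m : ℝ × ℝ, m ≠ 0 ∧ F = argmaxSet Ω m

/-- A (maximal) facet cut out by a horizontal supporting line; it can be a single point. -/
def IsHorizontalFacet (Ω F : Set (ℝ × ℝ)) : Prop :=
  F.Nonempty ∧ ∃ m : ℝ × ℝ, m ≠ 0 ∧ m.1 = 0 ∧ F = argmaxSet Ω m

/-- The extremal is singular along the face `F` of positive dimension (equivalently, with at least
two points) on the measurable set `S ⊆ [0, T]` of positive measure. -/
def IsSingularAlong (Ω : Set (ℝ × ℝ)) (T : ℝ) (q p : ℝ → ℝ × ℝ) (F : Set (ℝ × ℝ))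
    (S : Set ℝ) : Prop :=
  IsFace Ω F ∧ F.Nontrivial ∧ MeasurableSet S ∧ S ⊆ Icc 0 T ∧ 0 < volume S ∧
    ∀ᵐ t ∂volume.restrict S, argmaxSet Ω (momentum (q t) (p t)) = F

/-! ### The three families of extremals -/

/-- Type (i.a): nowhere singular, with the explicit formulas.  Here `η` is the angle of the
momentum, `(h₁, h₂) = (-cosh η, sinh η)`, with respect to the antipolar set. -/
def IsTypeA (Ω : Set (ℝ × ℝ)) (ω₀ : ℝ × ℝ) (T : ℝ) (q p : ℝ → ℝ × ℝ) : Prop :=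
  (¬ ∃ F S, IsSingularAlong Ω T q p F S) ∧
  ∃ (c₁ c₂ : ℝ) (η : ℝ → ℝ), c₁ ≠ 0 ∧
    ∀ t ∈ Icc 0 T,
      η t ∈ angleDomain (antipolar Ω) ω₀ ∧
      momentum (q t) (p t) =
        (-coshO (antipolar Ω) ω₀ (η t), sinhO (antipolar Ω) ω₀ (η t)) ∧
      (q t).1 = c₁ * sinhO (antipolar Ω) ω₀ (η t) + c₂ ∧
      (q t).2 = c₁ * coshO (antipolar Ω) ω₀ (η t) ∧
      coshO (antipolar Ω) ω₀ (η t) ≠ 0 ∧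
      HasDerivWithinAt η (coshO (antipolar Ω) ω₀ (η t)) (Icc 0 T) t ∧
      IntervalIntegrable (fun s => 1 / coshO (antipolar Ω) ω₀ s) volume (η 0) (η t) ∧
      t = ∫ s in (η 0)..(η t), 1 / coshO (antipolar Ω) ω₀ s

/-- Type (i.b): the control stays on the facet `F` with a horizontal supporting line, this line
being the one defined by the momentum at every time. -/
def IsTypeB (Ω : Set (ℝ × ℝ)) (T : ℝ) (q p u : ℝ → ℝ × ℝ) (F : Set (ℝ × ℝ)) : Prop :=
  IsHorizontalFacet Ω F ∧
  (∀ᵐ t ∂volume.restrict (Icc 0 T), u t ∈ F) ∧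
  ∀ t ∈ Icc 0 T, (momentum (q t) (p t)).1 = 0 ∧ argmaxSet Ω (momentum (q t) (p t)) = F

/-- The part in the upper half-plane of the line issuing from the unit element parallel to `l`. -/
def lightRay (l : Set (ℝ × ℝ)) : Set (ℝ × ℝ) :=
  {P | 0 < P.2 ∧ ∃ v ∈ l, P = affOne + v}

end

end LorentzAff

/-! The problem is left-invariant, so the left translations supply two first integrals, `p₁` and `k
= h₂ + p₁ a`. Since `ν` is positively homogeneous, the maximum of the Pontryagin function over `C`
can only be zero: `⟨h, u⟩ = λ₀ ν(u)`, and `⟨h, v⟩ ≤ λ₀ ν(v)` for all `v ∈ C`.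

Dichotomy. Property (*) makes `ν` positive exactly in the interior of `C`, the origin aside
(`nu_pos_iff`). If `λ₀ = 0`, a non-zero covector that is nonpositive on `C` can vanish only on `∂C`,
so `u ∈ ∂C`. If `λ₀ = -1`, then `⟨h, ·⟩ ≤ -1` on `Ω`, and `h` cannot vanish on a ray at distance
zero from `Ω`, so `u` is interior.

Timelike extremals. In natural parametrisation `⟨h, u⟩ = -1` is the maximum of `⟨h, ·⟩` on `Ω`, so
`π = (-h₁, h₂)` runs along the boundary of the antipolar set. For a curve on this boundary the angle
`η` has derivative `cross π π'` (`hasDerivAt_angle`), because the sector between nearby points is a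
triangle up to a relatively small error. Along an extremal `cross π π' = h₁ ⟨h, u⟩ = -h₁`, that is,
`η' = cosh η`; the two first integrals then express `a` and `b` through `η`. Here `h₁ = p₁ b`
vanishes identically or nowhere. If it vanishes, `h` is constant and vertical, and `u` stays on one
horizontal face. If it does not, `η` is strictly monotone, while a face with two points determines
`h`, hence `η`, hence `t`: there is no singular set of positive measure. The angle is a coordinate
on the boundary because it is additive (`Conoid.angle_add`) and each ray meets the boundary at most
once (`eq_of_cross_eq_zero`).

Lightlike extremals. Now `p` is constant and annihilates `u`. It cannot annihilate both extreme
directions of `C`, so the control keeps to one ray; conversely a covector annihilating that ray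
makes every segment along it extremal. -/

namespace LorentzAff

/-- The determinant of a pair of vectors of the plane. -/
def cross (v w : ℝ × ℝ) : ℝ := v.1 * w.2 - v.2 * w.1

/-- Cramer's rule. -/
theorem eq_cross_combo {v w : ℝ × ℝ} (h : cross v w ≠ 0) (z : ℝ × ℝ) :
    z = (cross z w / cross v w) • v + (cross v z / cross v w) • w := by
  ext
  all_goals
    simp only [Prod.fst_add, Prod.snd_add, Prod.smul_fst, Prod.smul_snd, smul_eq_mul]
    rw [div_mul_eq_mul_div, div_mul_eq_mul_div, ← add_div, eq_div_iff h]
    simp only [cross]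
    ring

theorem mem_smul_iff {Ω : Set (ℝ × ℝ)} {c : ℝ} (hc : 0 < c) {z : ℝ × ℝ} :
    z ∈ c • Ω ↔ c⁻¹ • z ∈ Ω :=
  Set.mem_smul_set_iff_inv_smul_mem₀ hc.ne' _ _

/-! ### The cone generated by `Ω`. -/

namespace PropI

variable {Ω : Set (ℝ × ℝ)}

theorem smul_mem (hI : PropI Ω) {c : ℝ} (hc : 1 ≤ c) {z : ℝ × ℝ} (hz : z ∈ Ω) : c • z ∈ Ω := by
  rcases hc.eq_or_lt with rfl | hc
  · simpa using hz
  · exact hI.ray c hc (smul_mem_smul_set hz)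

theorem mem_smul_anti (hI : PropI Ω) {c d : ℝ} (hc : 0 < c) (hcd : c ≤ d) {z : ℝ × ℝ}
    (hz : z ∈ d • Ω) : z ∈ c • Ω := by
  rw [mem_smul_iff (hc.trans_le hcd)] at hz
  rw [mem_smul_iff hc]
  have h := hI.smul_mem ((one_le_div hc).2 hcd) hz
  rw [smul_smul] at h
  convert h using 2
  field_simp [(hc.trans_le hcd).ne']

theorem mem_rayHull_iff {z : ℝ × ℝ} : z ∈ rayHull Ω ↔ ∃ c : ℝ, 0 ≤ c ∧ ∃ ω ∈ Ω, z = c • ω := by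
  unfold rayHull
  rw [Set.mem_smul]
  constructor
  · rintro ⟨c, hc, ω, hω, rfl⟩
    exact ⟨c, hc, ω, hω, rfl⟩
  · rintro ⟨c, hc, ω, hω, rfl⟩
    exact ⟨c, hc, ω, hω, rfl⟩

theorem subset_rayHull : Ω ⊆ rayHull Ω := fun ω hω =>
  mem_rayHull_iff.2 ⟨1, zero_le_one, ω, hω, (one_smul _ _).symm⟩

theorem zero_mem_rayHull (hI : PropI Ω) : (0 : ℝ × ℝ) ∈ rayHull Ω := by
  obtain ⟨ω, hω⟩ := hI.nonempty
  exact mem_rayHull_iff.2 ⟨0, le_rfl, ω, hω, by simp⟩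

theorem rayHull_smul {z : ℝ × ℝ} (hz : z ∈ rayHull Ω) {k : ℝ} (hk : 0 ≤ k) : k • z ∈ rayHull Ω := by
  obtain ⟨c, hc, ω, hω, rfl⟩ := mem_rayHull_iff.1 hz
  exact mem_rayHull_iff.2 ⟨k * c, by positivity, ω, hω, by rw [smul_smul]⟩

theorem rayHull_add (hI : PropI Ω) {z w : ℝ × ℝ} (hz : z ∈ rayHull Ω) (hw : w ∈ rayHull Ω) :
    z + w ∈ rayHull Ω := by
  obtain ⟨c, hc, ω, hω, rfl⟩ := mem_rayHull_iff.1 hz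
  obtain ⟨d, hd, ω', hω', rfl⟩ := mem_rayHull_iff.1 hw
  rcases (add_nonneg hc hd).eq_or_lt with h | h
  · have h1 : c = 0 := by linarith
    have h2 : d = 0 := by linarith
    simpa [h1, h2] using hI.zero_mem_rayHull
  · refine mem_rayHull_iff.2 ⟨c + d, h.le, (c / (c + d)) • ω + (d / (c + d)) • ω', ?_, ?_⟩
    · exact hI.convex hω hω' (by positivity) (by positivity) (by field_simp)
    · rw [smul_add, smul_smul, smul_smul]
      congr 2 <;> field_simp

theorem cone_smul {z : ℝ × ℝ} (hz : z ∈ cone Ω) {k : ℝ} (hk : 0 ≤ k) : k • z ∈ cone Ω :=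
  map_mem_closure (continuous_const_smul k) hz fun _ h => rayHull_smul h hk

theorem cone_add (hI : PropI Ω) {z w : ℝ × ℝ} (hz : z ∈ cone Ω) (hw : w ∈ cone Ω) :
    z + w ∈ cone Ω :=
  map_mem_closure₂ continuous_add hz hw fun _ h _ h' => hI.rayHull_add h h'

theorem isClosed_cone : IsClosed (cone Ω) := isClosed_closure

theorem subset_cone : Ω ⊆ cone Ω := subset_rayHull.trans subset_closure

theorem convex_rayHull (hI : PropI Ω) : Convex ℝ (rayHull Ω) := fun _ hx _ hy _ _ ha hb _ =>
  hI.rayHull_add (rayHull_smul hx ha) (rayHull_smul hy hb)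

theorem interior_cone_add (hI : PropI Ω) {z w : ℝ × ℝ} (hz : z ∈ interior (cone Ω))
    (hw : w ∈ cone Ω) : z + w ∈ interior (cone Ω) := by
  have ho : IsOpen (interior (cone Ω) + {w}) := isOpen_interior.add_right
  refine interior_maximal ?_ ho (add_mem_add hz rfl)
  rintro _ ⟨a, ha, b, hb, rfl⟩
  rw [mem_singleton_iff.1 hb]
  exact hI.cone_add (interior_subset ha) hw

theorem interior_cone_smul {z : ℝ × ℝ} (hz : z ∈ interior (cone Ω)) {k : ℝ} (hk : 0 < k) :
    k • z ∈ interior (cone Ω) := by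
  have ho : IsOpen (k • interior (cone Ω)) := isOpen_interior.smul₀ hk.ne'
  refine interior_maximal ?_ ho (smul_mem_smul_set hz)
  rintro _ ⟨a, ha, rfl⟩
  exact cone_smul (interior_subset ha) hk.le

/-- A closed set with empty interior is its own boundary; then `2ω`, for any `ω ∈ Ω`, would lie in
`2Ω ∩ ∂Ω`, against (*). -/
theorem interior_nonempty (hI : PropI Ω) (hS : PropStar Ω) : (interior Ω).Nonempty := by
  by_contra h
  rw [not_nonempty_iff_eq_empty] at h
  obtain ⟨ω, hω⟩ := hI.nonempty
  have h2 : (2 : ℝ) • ω ∈ (2 : ℝ) • Ω ∩ frontier Ω := by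
    refine ⟨smul_mem_smul_set hω, ?_⟩
    rw [hI.closed.frontier_eq, h, sdiff_empty]
    exact hI.smul_mem one_le_two hω
  rw [hS 2 one_lt_two] at h2
  exact h2

/-- A convex set with non-empty interior has the same interior as its closure, so passing to the
closure adds boundary points only. -/
theorem interior_cone_subset_rayHull (hI : PropI Ω) (hS : PropStar Ω) :
    interior (cone Ω) ⊆ rayHull Ω := by
  have hne : (interior (rayHull Ω)).Nonempty :=
    (hI.interior_nonempty hS).mono (interior_mono subset_rayHull)
  unfold cone
  rw [hI.convex_rayHull.interior_closure_eq_interior_of_nonempty_interior hne]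
  exact interior_subset

end PropI

/-! ### The two extreme rays of the cone. -/

/-- The closed ray spanned by a vector. -/
def rayOf (v : ℝ × ℝ) : Set (ℝ × ℝ) := {w | ∃ s : ℝ, 0 ≤ s ∧ w = s • v}

theorem rayOf_smul {v : ℝ × ℝ} {k : ℝ} (hk : 0 < k) : rayOf (k • v) = rayOf v := by
  ext w
  constructor
  · rintro ⟨s, hs, rfl⟩
    exact ⟨s * k, by positivity, by rw [smul_smul]⟩
  · rintro ⟨s, hs, rfl⟩
    exact ⟨s / k, by positivity, by rw [smul_smul]; congr 1; field_simp⟩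

theorem exists_near_of_iInf_infEDist {l Ω : Set (ℝ × ℝ)} (h : ⨅ x ∈ l, Metric.infEDist x Ω = 0)
    {ε : ℝ} (hε : 0 < ε) : ∃ x ∈ l, ∃ ω ∈ Ω, dist x ω < ε := by
  have h1 : ⨅ x ∈ l, Metric.infEDist x Ω < ENNReal.ofReal ε := by
    rw [h]; exact ENNReal.ofReal_pos.2 hε
  simp only [iInf_lt_iff] at h1
  obtain ⟨x, hx, h2⟩ := h1
  obtain ⟨ω, hω, h3⟩ := Metric.infEDist_lt_iff.1 h2
  refine ⟨x, hx, ω, hω, ?_⟩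
  rw [edist_dist] at h3
  exact (ENNReal.ofReal_lt_ofReal_iff hε).1 h3

/-- The two extreme directions of the cone `C`. -/
structure Frame (Ω l₀ l₁ : Set (ℝ × ℝ)) (v w : ℝ × ℝ) : Prop where
  cross_ne : cross v w ≠ 0
  ray₀ : l₀ = rayOf v
  ray₁ : l₁ = rayOf w
  cone_eq : cone Ω = {z | ∃ s r : ℝ, 0 ≤ s ∧ 0 ≤ r ∧ z = s • v + r • w}

/-- Otherwise `0 = e + (-e)` is interior, `C` is the whole plane, and its boundary is empty instead
of containing two rays. -/
theorem neg_notMem_cone {Ω l₀ l₁ : Set (ℝ × ℝ)} (hI : PropI Ω) (hSS : PropStarStar Ω l₀ l₁)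
    {e : ℝ × ℝ} (he : e ∈ interior (cone Ω)) : -e ∉ cone Ω := by
  intro h
  have h0 : (0 : ℝ × ℝ) ∈ interior (cone Ω) := by simpa using hI.interior_cone_add he h
  have hu : cone Ω = univ := by
    refine eq_univ_of_forall fun z => ?_
    have ht : Tendsto (fun n : ℕ => ((1 : ℝ) / ((n : ℝ) + 1)) • z) atTop (𝓝 0) := by
      simpa using (tendsto_one_div_add_atTop_nhds_zero_nat (𝕜 := ℝ)).smul_const z
    obtain ⟨n, hn⟩ := (ht.eventually (mem_interior_iff_mem_nhds.1 h0)).exists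
    have h2 := PropI.cone_smul hn (k := (n : ℝ) + 1) (by positivity)
    rw [smul_smul, mul_one_div_cancel (by positivity), one_smul] at h2
    exact h2
  have h1 := hSS.frontier_cone
  rw [hu, frontier_univ] at h1
  obtain ⟨v, -, hv⟩ := hSS.ray₀
  have : (0 : ℝ × ℝ) ∈ l₀ ∪ l₁ := Or.inl (by rw [hv]; exact ⟨0, le_rfl, by simp⟩)
  rw [← h1] at this
  exact this

/-- A line parallel to an interior direction of the cone meets its boundary. -/
theorem exists_mem_frontier_cone {Ω l₀ l₁ : Set (ℝ × ℝ)} (hI : PropI Ω)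
    (hSS : PropStarStar Ω l₀ l₁) {e : ℝ × ℝ} (he : e ∈ interior (cone Ω)) (w : ℝ × ℝ) :
    ∃ t : ℝ, t • e + w ∈ frontier (cone Ω) := by
  have hne := neg_notMem_cone hI hSS he
  have hcont : Continuous fun t : ℝ => t • e + w := by fun_prop
  have h0 : Tendsto (fun n : ℕ => ((1 : ℝ) / ((n : ℝ) + 1)) • w) atTop (𝓝 0) := by
    simpa using (tendsto_one_div_add_atTop_nhds_zero_nat (𝕜 := ℝ)).smul_const w
  have hp : Tendsto (fun n : ℕ => e + ((1 : ℝ) / ((n : ℝ) + 1)) • w) atTop (𝓝 e) := by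
    simpa using h0.const_add e
  have hm : Tendsto (fun n : ℕ => -e + ((1 : ℝ) / ((n : ℝ) + 1)) • w) atTop (𝓝 (-e)) := by
    simpa using h0.const_add (-e)
  obtain ⟨n, hn⟩ := (hp.eventually (mem_interior_iff_mem_nhds.1 he)).exists
  obtain ⟨m, hm⟩ := (hm.eventually (PropI.isClosed_cone.isOpen_compl.mem_nhds hne)).exists
  -- Far out in the direction `e` the line is in the cone, since `e + w / (n + 1)` is close to `e`;
  -- far out in the direction `-e` it is outside, since `-e + w / (m + 1)` is close to `-e`.
  have h1 : ((n : ℝ) + 1) • e + w ∈ cone Ω := by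
    have h2 := PropI.cone_smul hn (k := (n : ℝ) + 1) (by positivity)
    rwa [smul_add, smul_smul, mul_one_div_cancel (by positivity), one_smul] at h2
  have h2 : (-((m : ℝ) + 1)) • e + w ∉ cone Ω := by
    intro h
    apply hm
    have h2 := PropI.cone_smul h (k := 1 / ((m : ℝ) + 1)) (by positivity)
    rw [smul_add, smul_smul, mul_neg, one_div_mul_cancel (by positivity)] at h2
    simpa using h2
  have hpre : (frontier ((fun t : ℝ => t • e + w) ⁻¹' cone Ω)).Nonempty :=
    nonempty_frontier_iff.2 ⟨⟨_, h1⟩, fun h => h2 (eq_univ_iff_forall.1 h _)⟩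
  obtain ⟨t, ht⟩ := hpre
  exact ⟨t, hcont.frontier_preimage_subset _ ht⟩

/-- Two lines parallel to an interior direction `e`, on either side of the origin, meet `∂C` at
points `x` and `y`. No ray from the origin contains both, so `l₀` and `l₁` are the rays through
them. It remains to see that `x + y`, a multiple of `e`, is a positive one; then `x + y` is
interior, and `C` can contain nothing outside the span of `x` and `y` with nonnegative coefficients.
-/
theorem exists_frame {Ω l₀ l₁ : Set (ℝ × ℝ)} (hI : PropI Ω) (hS : PropStar Ω)
    (hSS : PropStarStar Ω l₀ l₁) : ∃ v w, Frame Ω l₀ l₁ v w := by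
  obtain ⟨e, he⟩ := (hI.interior_nonempty hS).mono (interior_mono PropI.subset_cone)
  have hne := neg_notMem_cone hI hSS he
  have hze : ∀ k : ℝ, k • e ∈ cone Ω → 0 ≤ k := by
    intro k hk
    by_contra hneg
    push Not at hneg
    apply hne
    have h2 := PropI.cone_smul hk (k := (-k)⁻¹) (inv_nonneg.2 (by linarith))
    rw [smul_smul, inv_neg, neg_mul, inv_mul_cancel₀ hneg.ne] at h2
    simpa using h2
  have he0 : e ≠ 0 := by
    rintro rfl
    exact hne (by simpa using interior_subset he)
  set d : ℝ × ℝ := (-e.2, e.1) with hd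
  have hed : cross e d ≠ 0 := by
    simp only [cross, hd]
    intro h
    apply he0
    have h1 : e.1 = 0 := by nlinarith [sq_nonneg e.1, sq_nonneg e.2]
    have h2 : e.2 = 0 := by nlinarith [sq_nonneg e.1, sq_nonneg e.2]
    exact Prod.ext h1 h2
  obtain ⟨t, ht⟩ := exists_mem_frontier_cone hI hSS he d
  obtain ⟨t', ht'⟩ := exists_mem_frontier_cone hI hSS he (-d)
  obtain ⟨v₀, hv₀, hl₀⟩ := hSS.ray₀
  obtain ⟨v₁, hv₁, hl₁⟩ := hSS.ray₁
  change l₀ = rayOf v₀ at hl₀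
  change l₁ = rayOf v₁ at hl₁
  set x := t • e + d with hx
  set y := t' • e + -d with hy
  have hxy : x + y = (t + t') • e := by rw [hx, hy]; module
  have hex : cross e x = cross e d := by simp [cross, hx]; ring
  have hey : cross e y = -cross e d := by simp [cross, hy]; ring
  have hxC : x ∈ cone Ω := by
    have := frontier_subset_closure ht
    rwa [PropI.isClosed_cone.closure_eq] at this
  have hyC : y ∈ cone Ω := by
    have := frontier_subset_closure ht'
    rwa [PropI.isClosed_cone.closure_eq] at this
  -- no ray contains both points
  have hsep : ∀ v, x ∈ rayOf v → y ∉ rayOf v := by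
    rintro v ⟨k, hk, hkx⟩ ⟨k', hk', hky⟩
    have h1 : k' * cross e x = k * cross e y := by
      rw [hkx, hky]; simp [cross]; ring
    rw [hex, hey] at h1
    have h2 : (k + k') * cross e d = 0 := by linarith
    have h3 : k + k' = 0 := (mul_eq_zero.1 h2).resolve_right hed
    have h4 : k = 0 := by linarith
    rw [h4, zero_smul] at hkx
    rw [hkx] at hex
    apply hed
    rw [← hex]; simp [cross]
  -- the ray through a nonzero point
  have hray : ∀ z v, cross e z ≠ 0 → z ∈ rayOf v → rayOf v = rayOf z := by
    rintro z v hz ⟨k, hk, rfl⟩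
    have hk0 : k ≠ 0 := by
      rintro rfl
      apply hz
      simp [cross]
    exact (rayOf_smul (lt_of_le_of_ne hk hk0.symm)).symm
  have hex0 : cross e x ≠ 0 := by rw [hex]; exact hed
  have hey0 : cross e y ≠ 0 := by rw [hey]; exact neg_ne_zero.2 hed
  have hcases : (l₀ = rayOf x ∧ l₁ = rayOf y) ∨ (l₀ = rayOf y ∧ l₁ = rayOf x) := by
    rw [hSS.frontier_cone, hl₀, hl₁] at ht ht'
    rcases ht with h | h <;> rcases ht' with h' | h'
    · exact absurd h' (hsep _ h)
    · left; rw [hl₀, hl₁]; exact ⟨hray _ _ hex0 h, hray _ _ hey0 h'⟩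
    · right; rw [hl₀, hl₁]; exact ⟨hray _ _ hey0 h', hray _ _ hex0 h⟩
    · exact absurd h' (hsep _ h)
  have hdist : ∀ ε : ℝ, 0 < ε → (∃ z ∈ rayOf x, ∃ ω ∈ Ω, dist z ω < ε) ∧
      (∃ z ∈ rayOf y, ∃ ω ∈ Ω, dist z ω < ε) := by
    intro ε hε
    have h0 := exists_near_of_iInf_infEDist hSS.dist₀ hε
    have h1 := exists_near_of_iInf_infEDist hSS.dist₁ hε
    rcases hcases with ⟨a, b⟩ | ⟨a, b⟩ <;> rw [a] at h0 <;> rw [b] at h1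
    · exact ⟨h0, h1⟩
    · exact ⟨h1, h0⟩
  have htt : 0 < t + t' := by
    refine lt_of_le_of_ne (hze _ (by rw [← hxy]; exact hI.cone_add hxC hyC)) fun h0 => ?_
    rw [← h0, zero_smul] at hxy
    have hyx : y = -x := by rw [eq_neg_iff_add_eq_zero, add_comm]; exact hxy
    -- If the two rays were opposite, points of `Ω` close to `s x` and to `-r x` would have a convex
    -- combination, with weights `r / (s + r)` and `s / (s + r)`, close to the origin. This excludes
    -- a half-plane.
    have hcl : (0 : ℝ × ℝ) ∈ closure Ω := by
      rw [Metric.mem_closure_iff]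
      intro ε hε
      obtain ⟨⟨z, ⟨s, hs, rfl⟩, ω, hω, h1⟩, ⟨z', ⟨r, hr, rfl⟩, ω', hω', h2⟩⟩ := hdist ε hε
      rcases (add_nonneg hs hr).eq_or_lt with h | h
      · have : s = 0 := by linarith
        exact ⟨ω, hω, by simpa [this] using h1⟩
      · refine ⟨(r / (s + r)) • ω + (s / (s + r)) • ω',
          hI.convex hω hω' (by positivity) (by positivity) (by field_simp; ring), ?_⟩
        have hz : (0 : ℝ × ℝ) = (r / (s + r)) • (s • x) + (s / (s + r)) • (r • y) := by
          rw [hyx, smul_smul, smul_smul, smul_neg, ← sub_eq_add_neg, ← sub_smul]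
          rw [eq_comm]
          convert zero_smul ℝ x using 2
          field_simp; ring
        have hb := convex_ball (0 : ℝ × ℝ) ε (show s • x - ω ∈ Metric.ball 0 ε by
            rwa [mem_ball_zero_iff, ← dist_eq_norm]) (show r • y - ω' ∈ Metric.ball 0 ε by
            rwa [mem_ball_zero_iff, ← dist_eq_norm])
            (show 0 ≤ r / (s + r) by positivity) (show 0 ≤ s / (s + r) by positivity)
            (by field_simp; ring)
        rw [mem_ball_zero_iff] at hb
        nth_rw 1 [hz]
        rw [dist_eq_norm]
        convert hb using 1
        congr 1
        module
    rw [hI.closed.closure_eq] at hcl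
    exact hI.zero_notMem hcl
  have hxyint : x + y ∈ interior (cone Ω) := by
    rw [hxy]; exact PropI.interior_cone_smul he htt
  have hcr : cross x y ≠ 0 := by
    have : cross x y = -(t + t') * cross e d := by simp [cross, hx, hy]; ring
    rw [this]
    exact mul_ne_zero (by linarith) hed
  have hxf : x ∉ interior (cone Ω) := fun h => ht.2 h
  have hyf : y ∉ interior (cone Ω) := fun h => ht'.2 h
  have hcone : cone Ω = {z | ∃ s r : ℝ, 0 ≤ s ∧ 0 ≤ r ∧ z = s • x + r • y} := by
    ext z
    constructor
    · intro hz
      have hzc := eq_cross_combo hcr z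
      set s := cross z y / cross x y
      set r := cross x z / cross x y
      suffices h : ¬ (s < 0 ∨ r < 0) by
        rw [not_or, not_lt, not_lt] at h
        exact ⟨s, r, h.1, h.2, hzc⟩
      intro hneg
      -- If the smaller coefficient is negative, the boundary point that goes with the larger one is
      -- a positive multiple of the interior point `x + y` plus a multiple of `z`, hence interior.
      -- If the coefficients are equal, `z` is a negative multiple of `e`.
      rcases lt_trichotomy s r with h | h | h
      · have hs : s < 0 := hneg.elim id h.trans
        apply hyf
        have h1 : y = (-s / (r - s)) • (x + y) + (1 / (r - s)) • z := by
          have : r - s ≠ 0 := by linarith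
          rw [hzc]
          match_scalars <;> field_simp <;> ring
        rw [h1]
        exact hI.interior_cone_add (PropI.interior_cone_smul hxyint
          (div_pos (by linarith) (by linarith))) (PropI.cone_smul hz
          (div_nonneg (by linarith) (by linarith)))
      · have hs : s < 0 := hneg.elim id fun h' => h ▸ h'
        rw [← h, ← smul_add, hxy, smul_smul] at hzc
        rw [hzc] at hz
        nlinarith [hze _ hz]
      · have hr : r < 0 := hneg.elim h.trans id
        apply hxf
        have h1 : x = (-r / (s - r)) • (x + y) + (1 / (s - r)) • z := by
          have : s - r ≠ 0 := by linarith
          rw [hzc]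
          match_scalars <;> field_simp <;> ring
        rw [h1]
        exact hI.interior_cone_add (PropI.interior_cone_smul hxyint
          (div_pos (by linarith) (by linarith))) (PropI.cone_smul hz
          (div_nonneg (by linarith) (by linarith)))
    · rintro ⟨s, r, hs, hr, rfl⟩
      exact hI.cone_add (PropI.cone_smul hxC hs) (PropI.cone_smul hyC hr)
  rcases hcases with ⟨a, b⟩ | ⟨a, b⟩
  · exact ⟨x, y, hcr, a, b, hcone⟩
  · refine ⟨y, x, ?_, a, b, ?_⟩
    · intro h; apply hcr; simp only [cross] at *; linarith
    · rw [hcone]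
      ext z
      constructor <;> rintro ⟨s, r, hs, hr, rfl⟩ <;> exact ⟨r, s, hr, hs, add_comm _ _⟩

end LorentzAff

/-! ### Linear functionals on the cone. -/

namespace LorentzAff

theorem pair_add (h z w : ℝ × ℝ) : pair h (z + w) = pair h z + pair h w := by
  simp [pair]; ring

theorem pair_smul (h z : ℝ × ℝ) (k : ℝ) : pair h (k • z) = k * pair h z := by
  simp [pair]; ring

theorem pair_sub (h z w : ℝ × ℝ) : pair h (z - w) = pair h z - pair h w := by
  simp [pair]; ring

theorem smul_pair (h z : ℝ × ℝ) (k : ℝ) : pair (k • h) z = k * pair h z := by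
  simp [pair]; ring

/-- The norm of `ℝ × ℝ` is the maximum norm, whose dual is the sum of the absolute values. -/
theorem abs_pair_le (h z : ℝ × ℝ) : |pair h z| ≤ (|h.1| + |h.2|) * ‖z‖ := by
  have h1 : |z.1| ≤ ‖z‖ := norm_fst_le z
  have h2 : |z.2| ≤ ‖z‖ := norm_snd_le z
  calc |pair h z| ≤ |h.1 * z.1| + |h.2 * z.2| := abs_add_le _ _
    _ = |h.1| * |z.1| + |h.2| * |z.2| := by rw [abs_mul, abs_mul]
    _ ≤ |h.1| * ‖z‖ + |h.2| * ‖z‖ := by gcongr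
    _ = _ := by ring

/-- A covector vanishing on two independent vectors is zero. -/
theorem eq_zero_of_pair_eq_zero {v w h : ℝ × ℝ} (hc : cross v w ≠ 0) (hv : pair h v = 0)
    (hw : pair h w = 0) : h = 0 := by
  unfold cross at hc
  unfold pair at hv hw
  have h1 : h.1 * (v.1 * w.2 - v.2 * w.1) = 0 := by linear_combination w.2 * hv - v.2 * hw
  have h2 : h.2 * (v.1 * w.2 - v.2 * w.1) = 0 := by linear_combination v.1 * hw - w.1 * hv
  exact Prod.ext ((mul_eq_zero.1 h1).resolve_right hc) ((mul_eq_zero.1 h2).resolve_right hc)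

theorem mem_rayOf_combo {v w : ℝ × ℝ} (hc : cross v w ≠ 0) {s r : ℝ} :
    s • v + r • w ∈ rayOf v ↔ 0 ≤ s ∧ r = 0 := by
  constructor
  · rintro ⟨k, hk, h⟩
    have h1 : cross v (s • v + r • w) = cross v (k • v) := by rw [h]
    have h2 : cross (s • v + r • w) w = cross (k • v) w := by rw [h]
    simp only [cross, Prod.fst_add, Prod.snd_add, Prod.smul_fst, Prod.smul_snd, smul_eq_mul]
      at h1 h2
    have h3 : r * cross v w = 0 := by unfold cross; linear_combination h1
    have h4 : (s - k) * cross v w = 0 := by unfold cross; linear_combination h2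
    have h5 := (mul_eq_zero.1 h4).resolve_right hc
    exact ⟨by linarith, (mul_eq_zero.1 h3).resolve_right hc⟩
  · rintro ⟨hs, rfl⟩
    exact ⟨s, hs, by simp⟩

namespace Frame

variable {Ω l₀ l₁ : Set (ℝ × ℝ)} {v w : ℝ × ℝ}

theorem symm (F : Frame Ω l₀ l₁ v w) : Frame Ω l₁ l₀ w v where
  cross_ne h := F.cross_ne (by simp only [cross] at *; linarith)
  ray₀ := F.ray₁
  ray₁ := F.ray₀
  cone_eq := by
    rw [F.cone_eq]
    ext z
    constructor <;> rintro ⟨s, r, hs, hr, rfl⟩ <;> exact ⟨r, s, hr, hs, add_comm _ _⟩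

theorem left_mem (F : Frame Ω l₀ l₁ v w) : v ∈ cone Ω := by
  rw [F.cone_eq]; exact ⟨1, 0, zero_le_one, le_rfl, by simp⟩

theorem right_mem (F : Frame Ω l₀ l₁ v w) : w ∈ cone Ω := F.symm.left_mem

theorem mem_ray_iff (F : Frame Ω l₀ l₁ v w) {s r : ℝ} :
    s • v + r • w ∈ l₀ ↔ 0 ≤ s ∧ r = 0 := by
  rw [F.ray₀]; exact mem_rayOf_combo F.cross_ne

theorem mem_ray_iff' (F : Frame Ω l₀ l₁ v w) {s r : ℝ} :
    s • v + r • w ∈ l₁ ↔ 0 ≤ r ∧ s = 0 := by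
  rw [add_comm]; exact F.symm.mem_ray_iff

theorem inter_eq (F : Frame Ω l₀ l₁ v w) : l₀ ∩ l₁ = {0} := by
  ext z
  rw [mem_singleton_iff]
  constructor
  · rintro ⟨h0, h1⟩
    have h2 := h0
    rw [F.ray₀] at h2
    obtain ⟨s, hs, rfl⟩ := h2
    have h3 : s • v = s • v + (0 : ℝ) • w := by simp
    rw [h3] at h1
    rw [(F.mem_ray_iff'.1 h1).2, zero_smul]
  · rintro rfl
    rw [F.ray₀, F.ray₁]
    exact ⟨⟨0, le_rfl, by simp⟩, ⟨0, le_rfl, by simp⟩⟩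

theorem ray_ne (F : Frame Ω l₀ l₁ v w) : l₀ ≠ l₁ := by
  intro h
  have h1 := F.inter_eq
  rw [← h, inter_self] at h1
  have hv : (1 : ℝ) • v + (0 : ℝ) • w ∈ l₀ := F.mem_ray_iff.2 ⟨zero_le_one, rfl⟩
  rw [h1, mem_singleton_iff] at hv
  apply F.cross_ne
  have hv' : v = 0 := by simpa using hv
  simp [hv', cross]

theorem mem_interior_iff (F : Frame Ω l₀ l₁ v w) (hSS : PropStarStar Ω l₀ l₁) {z : ℝ × ℝ} :
    z ∈ interior (cone Ω) ↔ ∃ s r : ℝ, 0 < s ∧ 0 < r ∧ z = s • v + r • w := by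
  have h1 : interior (cone Ω) = cone Ω \ frontier (cone Ω) := by
    rw [PropI.isClosed_cone.frontier_eq, sdiff_sdiff_right_self]
    exact (inter_eq_right.2 interior_subset).symm
  rw [h1, hSS.frontier_cone, F.cone_eq]
  constructor
  · rintro ⟨⟨s, r, hs, hr, rfl⟩, hn⟩
    rw [mem_union, F.mem_ray_iff, F.mem_ray_iff', not_or] at hn
    exact ⟨s, r, lt_of_le_of_ne hs fun h => hn.2 ⟨hr, h.symm⟩,
      lt_of_le_of_ne hr fun h => hn.1 ⟨hs, h.symm⟩, rfl⟩
  · rintro ⟨s, r, hs, hr, rfl⟩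
    refine ⟨⟨s, r, hs.le, hr.le, rfl⟩, ?_⟩
    rw [mem_union, F.mem_ray_iff, F.mem_ray_iff', not_or]
    exact ⟨fun h => hr.ne' h.2, fun h => hs.ne' h.2⟩

/-- A covector that is nonpositive on the cone and vanishes at an interior point is zero. -/
theorem eq_zero_of_interior (F : Frame Ω l₀ l₁ v w) (hSS : PropStarStar Ω l₀ l₁) {h u : ℝ × ℝ}
    (hC : ∀ z ∈ cone Ω, pair h z ≤ 0) (hu : u ∈ interior (cone Ω)) (h0 : pair h u = 0) :
    h = 0 := by
  obtain ⟨s, r, hs, hr, rfl⟩ := (F.mem_interior_iff hSS).1 hu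
  rw [pair_add, pair_smul, pair_smul] at h0
  have h1 := hC v F.left_mem
  have h2 := hC w F.right_mem
  refine eq_zero_of_pair_eq_zero F.cross_ne ?_ ?_
  · nlinarith [mul_nonneg hs.le (neg_nonneg.2 h1), mul_nonneg hr.le (neg_nonneg.2 h2)]
  · nlinarith [mul_nonneg hs.le (neg_nonneg.2 h1), mul_nonneg hr.le (neg_nonneg.2 h2)]

end Frame

section

variable {Ω l₀ l₁ : Set (ℝ × ℝ)}

theorem ray_subset_frontier (hSS : PropStarStar Ω l₀ l₁) :
    l₀ ⊆ frontier (cone Ω) ∧ l₁ ⊆ frontier (cone Ω) := by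
  rw [hSS.frontier_cone]; exact ⟨subset_union_left, subset_union_right⟩

theorem frontier_cone_smul (hSS : PropStarStar Ω l₀ l₁) {z : ℝ × ℝ}
    (hz : z ∈ frontier (cone Ω)) {k : ℝ} (hk : 0 ≤ k) : k • z ∈ frontier (cone Ω) := by
  have key : ∀ l, IsRay l → z ∈ l → k • z ∈ l := by
    rintro l ⟨v, -, rfl⟩ ⟨s, hs, rfl⟩
    exact ⟨k * s, by positivity, by rw [smul_smul]⟩
  rw [hSS.frontier_cone] at hz ⊢
  exact hz.imp (key _ hSS.ray₀) (key _ hSS.ray₁)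

/-- If `x ∈ Ω` were on `∂C`, so would be `2x`; as `Ω ⊆ C`, this places `2x` on `∂Ω`, against (*). -/
theorem subset_interior_cone (hI : PropI Ω) (hS : PropStar Ω) (hSS : PropStarStar Ω l₀ l₁) :
    Ω ⊆ interior (cone Ω) := by
  intro x hx
  by_contra hn
  have hf : x ∈ frontier (cone Ω) := ⟨subset_closure (PropI.subset_cone hx), hn⟩
  have h2 : (2 : ℝ) • x ∈ frontier (cone Ω) := frontier_cone_smul hSS hf zero_le_two
  have h3 : (2 : ℝ) • x ∈ (2 : ℝ) • Ω ∩ frontier Ω :=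
    ⟨smul_mem_smul_set hx, subset_closure (hI.smul_mem one_le_two hx),
      fun h => h2.2 (interior_mono PropI.subset_cone h)⟩
  rw [hS 2 one_lt_two] at h3
  exact h3

theorem mem_interior_of_mem_rayHull (hI : PropI Ω) (hS : PropStar Ω)
    (hSS : PropStarStar Ω l₀ l₁) {z : ℝ × ℝ} (hz : z ∈ rayHull Ω) (h0 : z ≠ 0) :
    z ∈ interior (cone Ω) := by
  obtain ⟨c, hc, ω, hω, rfl⟩ := PropI.mem_rayHull_iff.1 hz
  refine PropI.interior_cone_smul (subset_interior_cone hI hS hSS hω)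
    (lt_of_le_of_ne hc fun h => h0 ?_)
  rw [← h, zero_smul]

/-- A covector vanishing on a boundary ray of the cone is not bounded away from zero on `Ω`. -/
theorem exists_small_pair {l : Set (ℝ × ℝ)} (hd : ⨅ x ∈ l, Metric.infEDist x Ω = 0) {h : ℝ × ℝ}
    (hl : ∀ x ∈ l, pair h x = 0) {δ : ℝ} (hδ : 0 < δ) : ∃ ω ∈ Ω, |pair h ω| < δ := by
  set M := |h.1| + |h.2| + 1 with hM
  have hMpos : 0 < M := by positivity
  obtain ⟨x, hx, ω, hω, hxω⟩ := exists_near_of_iInf_infEDist hd (div_pos hδ hMpos)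
  refine ⟨ω, hω, ?_⟩
  have h1 : pair h ω = pair h (ω - x) := by rw [pair_sub, hl x hx, sub_zero]
  have h2 : ‖ω - x‖ < δ / M := by rwa [← dist_eq_norm, dist_comm]
  calc |pair h ω| ≤ (|h.1| + |h.2|) * ‖ω - x‖ := h1 ▸ abs_pair_le h _
    _ ≤ M * ‖ω - x‖ := by gcongr; linarith
    _ < M * (δ / M) := by gcongr
    _ = δ := by field_simp

/-! ### The anti-norm -/

/-- Taking the upper semicontinuous hull leaves the superlevel sets at positive levels unchanged,
because each `d Ω` is closed and these sets decrease in `d`. Every later use of the anti-norm at a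
positive level goes through this equivalence. -/
theorem le_antiNorm_iff (hI : PropI Ω) {c : ℝ} (hc : 0 < c) {z : ℝ × ℝ} :
    (c : EReal) ≤ antiNorm Ω z ↔ z ∈ c • Ω := by
  constructor
  · intro h
    -- A level `d < c` is needed to pass from the limsup to nearby points; afterwards `d` tends to
    -- `c` from below.
    have hsub : ∀ d : ℝ, 0 < d → d < c → z ∈ d • Ω := by
      intro d hd hdc
      have h1 : (d : EReal) < limsup (preNorm Ω) (𝓝 z) :=
        lt_of_lt_of_le (EReal.coe_lt_coe_iff.2 hdc) h
      have h2 : ∃ᶠ ζ in 𝓝 z, (d : EReal) < preNorm Ω ζ :=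
        frequently_lt_of_lt_limsup (by isBoundedDefault) h1
      have h3 : ∃ᶠ ζ in 𝓝 z, ζ ∈ d • Ω := by
        refine h2.mono fun ζ hζ => ?_
        obtain ⟨_, ⟨e, he, hζe, rfl⟩, hde⟩ := lt_sSup_iff.1 hζ
        exact hI.mem_smul_anti hd (EReal.coe_lt_coe_iff.1 hde).le hζe
      have h4 : IsClosed (d • Ω) := hI.closed.smul_of_ne_zero hd.ne'
      rw [← h4.closure_eq]
      exact mem_closure_iff_frequently.2 h3
    rw [mem_smul_iff hc]
    have ht : Tendsto (fun d : ℝ => d⁻¹ • z) (𝓝[<] c) (𝓝 (c⁻¹ • z)) := by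
      refine Tendsto.smul_const ?_ z
      exact (tendsto_inv₀ hc.ne').mono_left nhdsWithin_le_nhds
    refine hI.closed.mem_of_tendsto ht ?_
    have h5 : ∀ᶠ d : ℝ in 𝓝[<] c, 0 < d := nhdsWithin_le_nhds (lt_mem_nhds hc)
    filter_upwards [h5, self_mem_nhdsWithin] with d hd hdc
    exact (mem_smul_iff hd).1 (hsub d hd hdc)
  · intro h
    have h1 : (c : EReal) ≤ preNorm Ω z := le_sSup ⟨c, hc, h, rfl⟩
    -- The neighbourhoods in `𝓝 z` contain `z` itself, so the limsup is at least the value at `z`.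
    exact h1.trans (le_limsup_of_frequently_le'
      (Filter.Eventually.frequently (f := pure z) (by simp) |>.filter_mono (pure_le_nhds z)))

theorem antiNorm_ne_top (hI : PropI Ω) (z : ℝ × ℝ) : antiNorm Ω z ≠ ⊤ := by
  intro h
  have h1 : ∀ n : ℕ, (((n : ℝ) + 1)⁻¹) • z ∈ Ω := fun n =>
    (mem_smul_iff (by positivity)).1 ((le_antiNorm_iff hI (by positivity)).1 (h ▸ le_top))
  have h2 : Tendsto (fun n : ℕ => (((n : ℝ) + 1)⁻¹) • z) atTop (𝓝 0) := by
    have := (tendsto_one_div_add_atTop_nhds_zero_nat (𝕜 := ℝ)).smul_const z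
    simpa only [one_div, zero_smul] using this
  exact hI.zero_notMem (hI.closed.mem_of_tendsto h2 (Eventually.of_forall h1))

/-- If no `c Ω` contains `z`, then `preNorm` equals `⊥` at `z` and the bound comes from the hull
alone: points of `C`, the origin included, are limits of points `c ω` with `c > 0`. -/
theorem antiNorm_nonneg (hI : PropI Ω) {z : ℝ × ℝ} (hz : z ∈ cone Ω) : 0 ≤ antiNorm Ω z := by
  obtain ⟨ω, hω⟩ := hI.nonempty
  refine le_limsup_of_frequently_le' ?_
  have h1 : Tendsto (fun n : ℕ => ((1 : ℝ) / ((n : ℝ) + 1)) • ω) atTop (𝓝 0) := by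
    simpa using (tendsto_one_div_add_atTop_nhds_zero_nat (𝕜 := ℝ)).smul_const ω
  have h2 : z ∈ closure {ζ | ∃ c : ℝ, 0 < c ∧ ζ ∈ c • Ω} := by
    refine closure_minimal ?_ isClosed_closure hz
    intro y hy
    obtain ⟨c, hc, ω', hω', rfl⟩ := PropI.mem_rayHull_iff.1 hy
    rcases hc.eq_or_lt with rfl | hc
    · rw [zero_smul]
      exact mem_closure_of_tendsto h1 (Eventually.of_forall fun n =>
        ⟨_, by positivity, smul_mem_smul_set hω⟩)
    · exact subset_closure ⟨c, hc, smul_mem_smul_set hω'⟩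
  refine (mem_closure_iff_frequently.1 h2).mono ?_
  rintro ζ ⟨c, hc, hζ⟩
  have h3 : (c : EReal) ≤ preNorm Ω ζ := le_sSup ⟨c, hc, hζ, rfl⟩
  exact le_trans (EReal.coe_nonneg.2 hc.le) h3

theorem coe_nu (hI : PropI Ω) {z : ℝ × ℝ} (hz : z ∈ cone Ω) : (nu Ω z : EReal) = antiNorm Ω z :=
  EReal.coe_toReal (antiNorm_ne_top hI z)
    (ne_bot_of_gt (lt_of_lt_of_le (EReal.bot_lt_zero) (antiNorm_nonneg hI hz)))

theorem nu_nonneg (hI : PropI Ω) {z : ℝ × ℝ} (hz : z ∈ cone Ω) : 0 ≤ nu Ω z := by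
  rw [← EReal.coe_nonneg, coe_nu hI hz]; exact antiNorm_nonneg hI hz

theorem le_nu_iff (hI : PropI Ω) {z : ℝ × ℝ} (hz : z ∈ cone Ω) {c : ℝ} (hc : 0 < c) :
    c ≤ nu Ω z ↔ z ∈ c • Ω := by
  rw [← le_antiNorm_iff hI hc, ← coe_nu hI hz, EReal.coe_le_coe_iff]

theorem nu_smul (hI : PropI Ω) {z : ℝ × ℝ} (hz : z ∈ cone Ω) {k : ℝ} (hk : 0 < k) :
    nu Ω (k • z) = k * nu Ω z := by
  have hkz := PropI.cone_smul hz hk.le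
  have key : ∀ c : ℝ, 0 < c → (c ≤ nu Ω (k • z) ↔ c ≤ k * nu Ω z) := by
    intro c hc
    rw [le_nu_iff hI hkz hc, ← div_le_iff₀' hk, le_nu_iff hI hz (div_pos hc hk),
      mem_smul_iff hc, mem_smul_iff (div_pos hc hk), smul_smul, inv_div, div_eq_inv_mul]
  have h1 := nu_nonneg hI hz
  have h2 := nu_nonneg hI hkz
  apply le_antisymm
  · rcases h2.eq_or_lt with h | h
    · rw [← h]; positivity
    · exact (key _ h).1 le_rfl
  · rcases (mul_nonneg hk.le h1).eq_or_lt with h | h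
    · rw [← h]; exact h2
    · exact (key _ h).2 le_rfl

theorem one_le_nu (hI : PropI Ω) {z : ℝ × ℝ} (hz : z ∈ Ω) : 1 ≤ nu Ω z :=
  (le_nu_iff hI (PropI.subset_cone hz) one_pos).2 (by simpa using hz)

theorem mem_of_antiNorm_eq_one (hI : PropI Ω) {z : ℝ × ℝ} (hz : antiNorm Ω z = 1) : z ∈ Ω := by
  have := (le_antiNorm_iff hI one_pos (z := z)).1 (by rw [hz]; simp)
  simpa using this

/-- Off the origin, positivity of `ν` means membership in `ℝ₊ Ω`, and this set without the origin is
the interior of `C`. -/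
theorem nu_pos_iff (hI : PropI Ω) (hS : PropStar Ω) (hSS : PropStarStar Ω l₀ l₁) {z : ℝ × ℝ}
    (hz : z ∈ cone Ω) (h0 : z ≠ 0) : 0 < nu Ω z ↔ z ∈ interior (cone Ω) := by
  constructor
  · intro h
    have h1 := (le_nu_iff hI hz h).1 le_rfl
    refine mem_interior_of_mem_rayHull hI hS hSS ?_ h0
    obtain ⟨ω, hω, hz'⟩ := h1
    exact PropI.mem_rayHull_iff.2 ⟨_, h.le, ω, hω, hz'.symm⟩
  · intro h
    obtain ⟨c, hc, ω, hω, rfl⟩ :=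
      PropI.mem_rayHull_iff.1 (hI.interior_cone_subset_rayHull hS h)
    have hc' : 0 < c := lt_of_le_of_ne hc fun h => h0 (by rw [← h, zero_smul])
    exact lt_of_lt_of_le hc' ((le_nu_iff hI hz hc').2 (smul_mem_smul_set hω))

end

end LorentzAff

namespace LorentzAff

/-! ### Absolutely continuous functions on `[0, T]` -/

theorem ac_fst {T : ℝ} (hT : 0 ≤ T) {f : ℝ → ℝ × ℝ}
    (hf : ∃ K : NNReal, LipschitzOnWith K f (Icc 0 T)) :
    AbsolutelyContinuousOnInterval (fun t => (f t).1) 0 T := by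
  obtain ⟨K, hK⟩ := hf
  rw [← uIcc_of_le hT] at hK
  exact (LipschitzWith.prod_fst.comp_lipschitzOnWith hK).absolutelyContinuousOnInterval

theorem ac_snd {T : ℝ} (hT : 0 ≤ T) {f : ℝ → ℝ × ℝ}
    (hf : ∃ K : NNReal, LipschitzOnWith K f (Icc 0 T)) :
    AbsolutelyContinuousOnInterval (fun t => (f t).2) 0 T := by
  obtain ⟨K, hK⟩ := hf
  rw [← uIcc_of_le hT] at hK
  exact (LipschitzWith.prod_snd.comp_lipschitzOnWith hK).absolutelyContinuousOnInterval

theorem eq_of_ae_hasDerivAt_zero {T : ℝ} (hT : 0 ≤ T) {f : ℝ → ℝ}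
    (hf : AbsolutelyContinuousOnInterval f 0 T)
    (h : ∀ᵐ t ∂volume.restrict (Icc 0 T), HasDerivAt f 0 t) {t : ℝ} (ht : t ∈ Icc 0 T) :
    f t = f 0 := by
  rw [ae_restrict_iff' measurableSet_Icc, ← uIcc_of_le hT] at h
  obtain ⟨C, hC⟩ := hf.const_of_ae_hasDerivAt_zero h
  rw [uIcc_of_le hT] at hC
  rw [hC t ht, hC 0 ⟨le_rfl, hT⟩]

/-- A property that holds almost everywhere on `[0, T]` and is closed along the interval holds
everywhere on `[0, T]`. -/
theorem forall_mem_of_ae {T : ℝ} (hT : 0 < T) {X : Type*} [TopologicalSpace X] {f : ℝ → X}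
    (hf : ContinuousOn f (Icc 0 T)) {S : Set X} (hS : IsClosed S)
    (h : ∀ᵐ t ∂volume.restrict (Icc 0 T), f t ∈ S) {t : ℝ} (ht : t ∈ Icc 0 T) : f t ∈ S := by
  have h1 : ∀ᵐ t ∂volume.restrict (Ioo 0 T), f t ∈ S :=
    ae_mono (Measure.restrict_mono Ioo_subset_Icc_self le_rfl) h
  rw [ae_restrict_iff' measurableSet_Ioo] at h1
  have hd : Dense {t : ℝ | t ∈ Ioo 0 T → f t ∈ S} := Measure.dense_of_ae h1
  have h2 : Ioo 0 T ⊆ closure (Ioo 0 T ∩ {t : ℝ | t ∈ Ioo 0 T → f t ∈ S}) :=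
    hd.open_subset_closure_inter isOpen_Ioo
  have h3 : t ∈ closure (Ioo 0 T ∩ {t : ℝ | f t ∈ S}) := by
    have h4 : closure (Ioo 0 T) ⊆ closure (Ioo 0 T ∩ {t : ℝ | f t ∈ S}) := by
      refine closure_minimal (h2.trans (closure_mono ?_)) isClosed_closure
      exact fun x hx => ⟨hx.1, hx.2 hx.1⟩
    rw [closure_Ioo hT.ne] at h4
    exact h4 ht
  have h5 : MapsTo f (Ioo 0 T ∩ {t : ℝ | f t ∈ S}) S := fun x hx => hx.2
  have hcw : ContinuousWithinAt f (Ioo 0 T ∩ {t : ℝ | f t ∈ S}) t :=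
    (hf t ht).mono (inter_subset_left.trans Ioo_subset_Icc_self)
  have := hcw.mem_closure h3 h5
  rwa [hS.closure_eq] at this

theorem restrict_Icc_neBot {T : ℝ} (hT : 0 < T) : (ae (volume.restrict (Icc (0 : ℝ) T))).NeBot := by
  rw [ae_neBot]
  intro h
  rw [Measure.restrict_eq_zero, Real.volume_Icc, ENNReal.ofReal_eq_zero] at h
  linarith

/-! ### The equations of the maximum principle -/

theorem gradP_eq (Ω : Set (ℝ × ℝ)) (lam : ℝ) (q p u : ℝ × ℝ) :
    gradP Ω lam q p u = (q.2 * u.1, q.2 * u.2) := by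
  have h1 : HasDerivAt (fun x => pontryagin Ω lam q (x, p.2) u) (q.2 * u.1) p.1 := by
    simpa [pontryagin, pair, dL] using
      (((hasDerivAt_id p.1).mul_const (q.2 * u.1)).add_const (p.2 * (q.2 * u.2))).sub_const
        (lam * nu Ω u)
  have h2 : HasDerivAt (fun y => pontryagin Ω lam q (p.1, y) u) (q.2 * u.2) p.2 := by
    simpa [pontryagin, pair, dL] using
      (((hasDerivAt_id p.2).mul_const (q.2 * u.2)).const_add (p.1 * (q.2 * u.1))).sub_const
        (lam * nu Ω u)
  simp only [gradP, h1.deriv, h2.deriv]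

theorem gradQ_eq (Ω : Set (ℝ × ℝ)) (lam : ℝ) (q p u : ℝ × ℝ) :
    gradQ Ω lam q p u = (0, pair p u) := by
  have h2 : HasDerivAt (fun y => pontryagin Ω lam (q.1, y) p u) (pair p u) q.2 := by
    have := ((((hasDerivAt_id q.2).mul_const u.1).const_mul p.1).add
      (((hasDerivAt_id q.2).mul_const u.2).const_mul p.2)).sub_const (lam * nu Ω u)
    simpa [pontryagin, pair, dL, Pi.add_def] using this
  simp only [gradQ, h2.deriv, Prod.mk.injEq, and_true]
  simp [pontryagin, pair, dL]

theorem pontryagin_eq (Ω : Set (ℝ × ℝ)) (lam : ℝ) (q p u : ℝ × ℝ) :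
    pontryagin Ω lam q p u = pair (momentum q p) u - lam * nu Ω u := by
  simp [pontryagin, pair, dL, momentum]; ring

/-- The pointwise content of the maximum principle. -/
structure ExtremalAt (Ω : Set (ℝ × ℝ)) (lam : ℝ) (q p u : ℝ → ℝ × ℝ) (t : ℝ) : Prop where
  deriv_a : HasDerivAt (fun s => (q s).1) ((q t).2 * (u t).1) t
  deriv_b : HasDerivAt (fun s => (q s).2) ((q t).2 * (u t).2) t
  deriv_p₁ : HasDerivAt (fun s => (p s).1) 0 t
  deriv_p₂ : HasDerivAt (fun s => (p s).2) (-pair (p t) (u t)) t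
  mem : u t ∈ cone Ω
  ne_zero : u t ≠ 0
  pair_eq : pair (momentum (q t) (p t)) (u t) = lam * nu Ω (u t)
  pair_le : ∀ v ∈ cone Ω, pair (momentum (q t) (p t)) v ≤ lam * nu Ω v

variable {Ω l₀ l₁ : Set (ℝ × ℝ)} {lam T : ℝ} {q p u : ℝ → ℝ × ℝ} {v w : ℝ × ℝ}

theorem IsExtremal.ae_extremalAt (hI : PropI Ω) (E : IsExtremal Ω lam T q p u) :
    ∀ᵐ t ∂volume.restrict (Icc 0 T), t ∈ Icc 0 T ∧ ExtremalAt Ω lam q p u t := by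
  filter_upwards [E.u_mem, E.u_ne_zero, E.q_eq, E.p_eq, E.maximum,
    ae_restrict_mem measurableSet_Icc] with t h1 h2 h3 h4 h5 h6
  rw [gradP_eq] at h3
  rw [gradQ_eq] at h4
  simp only [pontryagin_eq] at h5
  -- Comparison of `u` with `2u` and with `u / 2` shows that the maximal value of a homogeneous
  -- function is zero.
  have hz : pair (momentum (q t) (p t)) (u t) = lam * nu Ω (u t) := by
    have h7 := h5 _ (PropI.cone_smul h1 (k := 2) zero_le_two)
    have h8 := h5 _ (PropI.cone_smul h1 (k := 1 / 2) (by norm_num))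
    rw [nu_smul hI h1 (by norm_num), pair_smul] at h7 h8
    linarith
  refine ⟨h6, h3.fst, h3.snd, ?_, ?_, h1, h2, hz, ?_⟩
  · simpa using h4.hasFDerivAt.fst.hasDerivAt
  · simpa using h4.hasFDerivAt.snd.hasDerivAt
  · intro v hv
    have := h5 v hv
    linarith

/-- In the abnormal case `h` is nonpositive on `C` and zero at `u`; at an interior point this is
possible only for `h = 0`. -/
theorem ExtremalAt.mem_frontier (F : Frame Ω l₀ l₁ v w) (hSS : PropStarStar Ω l₀ l₁) {t : ℝ}
    (E : ExtremalAt Ω 0 q p u t) (hne : momentum (q t) (p t) ≠ 0) :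
    u t ∈ frontier (cone Ω) := by
  refine ⟨subset_closure E.mem, fun hint => hne ?_⟩
  refine F.eq_zero_of_interior hSS (fun z hz => ?_) hint ?_
  · simpa using E.pair_le z hz
  · simpa using E.pair_eq

/-- A control on `∂C` has `ν(u) = 0`, so `h` vanishes on its whole ray. That ray is at distance zero
from `Ω`, hence `|⟨h, ω⟩| < 1` for some `ω ∈ Ω`, whereas normality gives `⟨h, ω⟩ ≤ -ν(ω) ≤ -1`. -/
theorem ExtremalAt.mem_interior (hI : PropI Ω) (hS : PropStar Ω) (hSS : PropStarStar Ω l₀ l₁)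
    {t : ℝ} (E : ExtremalAt Ω (-1) q p u t) : u t ∈ interior (cone Ω) := by
  by_contra hn
  have hnu : nu Ω (u t) = 0 := by
    have h1 := (nu_pos_iff hI hS hSS E.mem E.ne_zero).not.2 hn
    linarith [nu_nonneg hI E.mem]
  have h0 : pair (momentum (q t) (p t)) (u t) = 0 := by rw [E.pair_eq, hnu, mul_zero]
  have key : ∀ l, IsRay l → ⨅ x ∈ l, Metric.infEDist x Ω = 0 → u t ∉ l := by
    rintro l ⟨x, hx, rfl⟩ hd ⟨s, hs, hus⟩
    have hs0 : s ≠ 0 := by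
      rintro rfl
      exact E.ne_zero (by rw [hus, zero_smul])
    have hpx : pair (momentum (q t) (p t)) x = 0 := by
      rw [hus, pair_smul] at h0
      exact (mul_eq_zero.1 h0).resolve_left hs0
    obtain ⟨ω, hω, h1⟩ := exists_small_pair hd (h := momentum (q t) (p t))
      (by rintro _ ⟨k, -, rfl⟩; rw [pair_smul, hpx, mul_zero]) one_pos
    have h2 := E.pair_le ω (PropI.subset_cone hω)
    have h3 := one_le_nu hI hω
    rw [abs_lt] at h1
    linarith
  have hf : u t ∈ frontier (cone Ω) := ⟨subset_closure E.mem, hn⟩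
  rw [hSS.frontier_cone] at hf
  exact hf.elim (key _ hSS.ray₀ hSS.dist₀) (key _ hSS.ray₁ hSS.dist₁)

theorem IsExtremal.momentum_ne_zero (E : IsExtremal Ω 0 T q p u) {t : ℝ} (ht : t ∈ Icc 0 T) :
    momentum (q t) (p t) ≠ 0 := by
  intro h
  have h1 := congrArg Prod.fst h
  have h2 := congrArg Prod.snd h
  have hq := (E.q_mem t ht).ne'
  simp only [momentum, Prod.fst_zero, Prod.snd_zero] at h1 h2
  exact E.nontrivial t ht (Prod.ext rfl
    (Prod.ext ((mul_eq_zero.1 h1).resolve_left hq) ((mul_eq_zero.1 h2).resolve_left hq)))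

theorem nu_eq_zero_of_mem_frontier (hI : PropI Ω) (hS : PropStar Ω) (hSS : PropStarStar Ω l₀ l₁)
    {z : ℝ × ℝ} (hz : z ∈ frontier (cone Ω)) (h0 : z ≠ 0) : antiNorm Ω z = 0 := by
  have hzC : z ∈ cone Ω := by
    have := hz.1
    rwa [PropI.isClosed_cone.closure_eq] at this
  rw [← coe_nu hI hzC]
  have h1 := (nu_pos_iff hI hS hSS hzC h0).not.2 hz.2
  have h2 : nu Ω z = 0 := le_antisymm (not_lt.1 h1) (nu_nonneg hI hzC)
  rw [h2, EReal.coe_zero]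

/-- Every extremal is either normal and timelike or abnormal and lightlike. -/
theorem IsExtremal.timelike_or_lightlike (hI : PropI Ω) (hS : PropStar Ω)
    (hSS : PropStarStar Ω l₀ l₁) (E : IsExtremal Ω lam T q p u) :
    (lam = -1 ∧ IsTimelike Ω T u ∧ ¬ IsLightlike Ω T u) ∨
      (lam = 0 ∧ IsLightlike Ω T u ∧ ¬ IsTimelike Ω T u) := by
  obtain ⟨v, w, F⟩ := exists_frame hI hS hSS
  have := restrict_Icc_neBot E.T_pos
  have hae := E.ae_extremalAt hI
  rcases E.lam_mem with rfl | rfl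
  · right
    have hfr : ∀ᵐ t ∂volume.restrict (Icc 0 T), u t ∈ frontier (cone Ω) := by
      filter_upwards [hae] with t ht
      exact ht.2.mem_frontier F hSS (E.momentum_ne_zero ht.1)
    refine ⟨rfl, ?_, fun hL => ?_⟩
    · filter_upwards [hae, hfr] with t ht h2
      exact nu_eq_zero_of_mem_frontier hI hS hSS h2 ht.2.ne_zero
    · obtain ⟨t, h1, h2, h3⟩ := (hae.and (hfr.and hL)).exists
      exact h2.2 (mem_interior_of_mem_rayHull hI hS hSS h3 h1.2.ne_zero)
  · left
    have hin : ∀ᵐ t ∂volume.restrict (Icc 0 T), u t ∈ interior (cone Ω) := by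
      filter_upwards [hae] with t ht
      exact ht.2.mem_interior hI hS hSS
    refine ⟨rfl, ?_, fun hL => ?_⟩
    · filter_upwards [hin] with t ht
      exact hI.interior_cone_subset_rayHull hS ht
    · obtain ⟨t, h1, h2, h3⟩ := (hae.and (hin.and hL)).exists
      have h4 := (nu_pos_iff hI hS hSS h1.2.mem h1.2.ne_zero).2 h2
      rw [← coe_nu hI h1.2.mem, EReal.coe_eq_zero] at h3
      exact h4.ne' h3

theorem IsExtremal.lam_eq_of_timelike (hI : PropI Ω) (hS : PropStar Ω)
    (hSS : PropStarStar Ω l₀ l₁) (E : IsExtremal Ω lam T q p u) (hu : IsTimelike Ω T u) :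
    lam = -1 :=
  (E.timelike_or_lightlike hI hS hSS).elim (·.1) fun h => absurd hu h.2.2

theorem IsExtremal.lam_eq_of_lightlike (hI : PropI Ω) (hS : PropStar Ω)
    (hSS : PropStarStar Ω l₀ l₁) (E : IsExtremal Ω lam T q p u) (hu : IsLightlike Ω T u) :
    lam = 0 :=
  (E.timelike_or_lightlike hI hS hSS).elim (fun h => absurd hu h.2.2) (·.1)

/-- The Pontryagin function does not involve `a`. -/
theorem IsExtremal.p₁_const (hI : PropI Ω) (E : IsExtremal Ω lam T q p u) {t : ℝ}
    (ht : t ∈ Icc 0 T) : (p t).1 = (p 0).1 :=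
  eq_of_ae_hasDerivAt_zero E.T_pos.le (ac_fst E.T_pos.le E.p_lipschitz)
    ((E.ae_extremalAt hI).mono fun _ h => h.2.deriv_p₁) ht

/-! ### Faces with a horizontal supporting line -/

theorem argmaxSet_smul {m : ℝ × ℝ} {k : ℝ} (hk : 0 < k) : argmaxSet Ω (k • m) = argmaxSet Ω m := by
  unfold argmaxSet
  simp only [smul_pair, mul_le_mul_iff_right₀ hk]

/-- With a maximum point `x` also `2x` is in `Ω`, so the maximum cannot be positive. -/
theorem pair_nonpos_of_argmax (hI : PropI Ω) {m x : ℝ × ℝ} (hx : x ∈ argmaxSet Ω m) :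
    ∀ z ∈ Ω, pair m z ≤ 0 := by
  intro z hz
  have h1 := hx.2 z hz
  have h2 := hx.2 _ (hI.smul_mem one_le_two hx.1)
  rw [pair_smul] at h2
  linarith

/-- Two vertical covectors are proportional. A positive factor gives the same face; with a negative
one both functionals are nonpositive on `Ω`, which puts `Ω` on the line `z.2 = 0` and leaves it
without interior. -/
theorem horizontalFacet_unique (hI : PropI Ω) (hS : PropStar Ω) {F F' : Set (ℝ × ℝ)}
    (hF : IsHorizontalFacet Ω F) (hF' : IsHorizontalFacet Ω F') : F = F' := by
  obtain ⟨⟨x, hx⟩, m, hm, hm1, rfl⟩ := hF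
  obtain ⟨⟨y, hy⟩, n, hn, hn1, rfl⟩ := hF'
  have hm2 : m.2 ≠ 0 := fun h => hm (Prod.ext hm1 h)
  have hn2 : n.2 ≠ 0 := fun h => hn (Prod.ext hn1 h)
  have hmn : n = (n.2 / m.2) • m := by
    ext
    · simp [hm1, hn1]
    · simp [hm2]
  rcases lt_or_gt_of_ne (div_ne_zero hn2 hm2) with h | h
  · exfalso
    obtain ⟨e, he⟩ := hI.interior_nonempty hS
    have h0 : ∀ z ∈ Ω, z.2 = 0 := by
      intro z hz
      have h1 := pair_nonpos_of_argmax hI hx z hz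
      have h2 := pair_nonpos_of_argmax hI hy z hz
      rw [hmn, smul_pair] at h2
      have h3 : pair m z = 0 := le_antisymm h1 (by nlinarith)
      simp only [pair, hm1, zero_mul, zero_add] at h3
      exact (mul_eq_zero.1 h3).resolve_left hm2
    have ht : Tendsto (fun n : ℕ => e + ((1 : ℝ) / ((n : ℝ) + 1)) • ((0, 1) : ℝ × ℝ)) atTop
        (𝓝 e) := by
      simpa using ((tendsto_one_div_add_atTop_nhds_zero_nat (𝕜 := ℝ)).smul_const
        ((0, 1) : ℝ × ℝ)).const_add e
    obtain ⟨k, hk⟩ := (ht.eventually (mem_interior_iff_mem_nhds.1 he)).exists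
    have h1 := h0 _ hk
    have h2 := h0 _ (interior_subset he)
    simp only [Prod.snd_add, h2, Prod.smul_snd, smul_eq_mul, mul_one, zero_add] at h1
    have : (0 : ℝ) < 1 / ((k : ℝ) + 1) := by positivity
    linarith
  · rw [hmn, argmaxSet_smul h]

/-- On a face with a horizontal supporting line the second coordinate grows exponentially. -/
theorem IsExtremal.exp_of_mem_horizontalFacet (hI : PropI Ω) (E : IsExtremal Ω lam T q p u)
    {F : Set (ℝ × ℝ)} (hF : IsHorizontalFacet Ω F)
    (hu : ∀ᵐ t ∂volume.restrict (Icc 0 T), u t ∈ F) :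
    ∃ c₃ c₄ : ℝ, 0 < c₃ ∧ (∀ ω ∈ F, ω.2 = c₄) ∧
      ∀ t ∈ Icc 0 T, (q t).2 = c₃ * Real.exp (c₄ * t) := by
  obtain ⟨⟨x, hx⟩, m, hm, hm1, rfl⟩ := hF
  have hm2 : m.2 ≠ 0 := fun h => hm (Prod.ext hm1 h)
  have hconst : ∀ ω ∈ argmaxSet Ω m, ω.2 = x.2 := by
    intro ω hω
    have h1 := le_antisymm (hω.2 x hx.1) (hx.2 ω hω.1)
    simp only [pair, hm1, zero_mul, zero_add] at h1
    exact (mul_left_cancel₀ hm2 h1).symm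
  refine ⟨(q 0).2, x.2, E.q_mem 0 ⟨le_rfl, E.T_pos.le⟩, hconst, fun t ht => ?_⟩
  -- Integrating factor for `b' = c₄ b`; the equation holds only almost everywhere, whence the
  -- absolute continuity.
  have hexp : AbsolutelyContinuousOnInterval (fun t => Real.exp (-(x.2 * t))) 0 T := by
    refine ContDiffOn.absolutelyContinuousOnInterval ?_
    fun_prop
  have hac := (ac_snd E.T_pos.le E.q_lipschitz).fun_mul hexp
  have h0 : ∀ᵐ t ∂volume.restrict (Icc 0 T),
      HasDerivAt (fun t => (q t).2 * Real.exp (-(x.2 * t))) 0 t := by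
    filter_upwards [E.ae_extremalAt hI, hu] with t h1 h2
    have h3 : HasDerivAt (fun t => Real.exp (-(x.2 * t)))
        (Real.exp (-(x.2 * t)) * (-(x.2 * 1))) t :=
      (((hasDerivAt_id t).const_mul x.2).neg).exp
    have h4 := h1.2.deriv_b.mul h3
    have h5 : (q t).2 * (u t).2 * Real.exp (-(x.2 * t)) +
        (q t).2 * (Real.exp (-(x.2 * t)) * (-(x.2 * 1))) = 0 := by
      rw [hconst _ h2]
      ring
    rwa [h5] at h4
  have h1 := eq_of_ae_hasDerivAt_zero E.T_pos.le hac h0 ht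
  simp only [mul_zero, neg_zero, Real.exp_zero, mul_one] at h1
  rw [← h1, mul_assoc, ← Real.exp_add]
  simp

end LorentzAff

namespace LorentzAff

/-! ### Areas of triangles and sectors -/

theorem volume_standard_triangle :
    volume {z : ℝ × ℝ | 0 ≤ z.1 ∧ 0 ≤ z.2 ∧ z.1 + z.2 < 1} = ENNReal.ofReal (1 / 2) := by
  have hm : MeasurableSet {z : ℝ × ℝ | 0 ≤ z.1 ∧ 0 ≤ z.2 ∧ z.1 + z.2 < 1} :=
    (measurableSet_le measurable_const measurable_fst).inter
      ((measurableSet_le measurable_const measurable_snd).inter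
        (measurableSet_lt (measurable_fst.add measurable_snd) measurable_const))
  rw [Measure.volume_eq_prod, Measure.prod_apply hm]
  have h1 : ∀ x : ℝ, volume (Prod.mk x ⁻¹' {z : ℝ × ℝ | 0 ≤ z.1 ∧ 0 ≤ z.2 ∧ z.1 + z.2 < 1}) =
      (Icc (0 : ℝ) 1).indicator (fun x => ENNReal.ofReal (1 - x)) x := by
    intro x
    by_cases hx : x ∈ Icc (0 : ℝ) 1
    · rw [indicator_of_mem hx]
      have : Prod.mk x ⁻¹' {z : ℝ × ℝ | 0 ≤ z.1 ∧ 0 ≤ z.2 ∧ z.1 + z.2 < 1} = Ico 0 (1 - x) := by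
        ext y
        simp only [mem_preimage, mem_ofPred_eq, mem_Ico]
        exact ⟨fun h => ⟨h.2.1, by linarith [h.2.2]⟩, fun h => ⟨hx.1, h.1, by linarith [h.2]⟩⟩
      rw [this, Real.volume_Ico, sub_zero]
    · rw [indicator_of_notMem hx]
      have : Prod.mk x ⁻¹' {z : ℝ × ℝ | 0 ≤ z.1 ∧ 0 ≤ z.2 ∧ z.1 + z.2 < 1} = ∅ := by
        ext y
        simp only [mem_preimage, mem_ofPred_eq, mem_empty_iff_false, iff_false]
        exact fun h => hx ⟨h.1, by linarith [h.2.1, h.2.2]⟩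
      rw [this, measure_empty]
  simp_rw [h1]
  rw [lintegral_indicator measurableSet_Icc, ← ofReal_integral_eq_lintegral_ofReal]
  · rw [integral_Icc_eq_integral_Ioc, ← intervalIntegral.integral_of_le zero_le_one]
    congr 1
    rw [intervalIntegral.integral_sub (by simp) (by simp)]
    simp
    norm_num
  · exact (continuous_const.sub continuous_id).integrableOn_Icc
  · filter_upwards [ae_restrict_mem measurableSet_Icc] with x hx
    simpa using hx.2

/-- The triangle cut off from the cone spanned by `ω₁`, `ω₂` by the line through `α⁻¹ ω₁` and
`β⁻¹ ω₂`. -/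
def triangle (α β : ℝ) (ω₁ ω₂ : ℝ × ℝ) : Set (ℝ × ℝ) :=
  {z | ∃ s r : ℝ, 0 ≤ s ∧ 0 ≤ r ∧ α * s + β * r < 1 ∧ z = s • ω₁ + r • ω₂}

theorem volume_triangle {α β : ℝ} (hα : 0 < α) (hβ : 0 < β) (ω₁ ω₂ : ℝ × ℝ) :
    volume (triangle α β ω₁ ω₂) = ENNReal.ofReal (|cross ω₁ ω₂| / (2 * (α * β))) := by
  set f : (ℝ × ℝ) →ₗ[ℝ] (ℝ × ℝ) :=
    Matrix.toLin (Module.Basis.finTwoProd ℝ) (Module.Basis.finTwoProd ℝ)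
      !![ω₁.1 / α, ω₂.1 / β; ω₁.2 / α, ω₂.2 / β] with hf
  have hfa : ∀ z : ℝ × ℝ, f z = (z.1 / α) • ω₁ + (z.2 / β) • ω₂ := by
    intro z
    rw [hf, Matrix.toLin_finTwoProd_apply]
    ext <;> simp <;> ring
  have himg : triangle α β ω₁ ω₂ = f '' {z : ℝ × ℝ | 0 ≤ z.1 ∧ 0 ≤ z.2 ∧ z.1 + z.2 < 1} := by
    ext z
    constructor
    · rintro ⟨s, r, hs, hr, hsr, rfl⟩
      refine ⟨(α * s, β * r), ⟨by positivity, by positivity, hsr⟩, ?_⟩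
      rw [hfa]
      simp only
      rw [mul_div_cancel_left₀ _ hα.ne', mul_div_cancel_left₀ _ hβ.ne']
    · rintro ⟨y, ⟨h1, h2, h3⟩, rfl⟩
      refine ⟨y.1 / α, y.2 / β, by positivity, by positivity, ?_, hfa y⟩
      rwa [mul_div_cancel₀ _ hα.ne', mul_div_cancel₀ _ hβ.ne']
  have hdet : LinearMap.det f = cross ω₁ ω₂ / (α * β) := by
    rw [hf, LinearMap.det_toLin, Matrix.det_fin_two_of]
    unfold cross
    field_simp
  rw [himg, Measure.addHaar_image_linearMap, hdet, volume_standard_triangle,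
    ← ENNReal.ofReal_mul (abs_nonneg _), abs_div, abs_of_pos (mul_pos hα hβ)]
  congr 1
  field_simp

theorem sector_comm (A : Set (ℝ × ℝ)) (ω₁ ω₂ : ℝ × ℝ) : sector A ω₁ ω₂ = sector A ω₂ ω₁ := by
  have key : ∀ x y : ℝ × ℝ, sector A x y ⊆ sector A y x := by
    rintro x y _ ⟨⟨s, r, hs, hr, rfl⟩, hn⟩
    exact ⟨⟨r, s, hr, hs, add_comm _ _⟩, hn⟩
  exact Subset.antisymm (key _ _) (key _ _)

theorem angle_comm (A : Set (ℝ × ℝ)) (ω₁ ω₂ : ℝ × ℝ) : angle A ω₁ ω₂ = -angle A ω₂ ω₁ := by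
  unfold angle
  rw [sector_comm A ω₁ ω₂, ← neg_mul, ← Real.sign_neg]
  congr 2
  ring

/-! ### The sectorial angle: comparison with triangles and additivity. -/

/-- A closed convex set with the ray property on which a linear functional is positive. -/
structure Conoid (A : Set (ℝ × ℝ)) (f : ℝ × ℝ) : Prop where
  convex : Convex ℝ A
  closed : IsClosed A
  smul_mem : ∀ c : ℝ, 1 ≤ c → ∀ z ∈ A, c • z ∈ A
  pos : ∀ z ∈ A, 0 < pair f z

namespace Conoid

variable {A : Set (ℝ × ℝ)} {f ω₀ ω₁ ω₂ : ℝ × ℝ}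

/-- If `s + r ≥ 1`, then `s ω₁ + r ω₂` is `s + r` times a convex combination of points of `A`, hence
lies in `A`. -/
theorem sector_subset (hA : Conoid A f) (h₁ : ω₁ ∈ A) (h₂ : ω₂ ∈ A) :
    sector A ω₁ ω₂ ⊆ triangle 1 1 ω₁ ω₂ := by
  rintro _ ⟨⟨s, r, hs, hr, rfl⟩, hn⟩
  refine ⟨s, r, hs, hr, ?_, rfl⟩
  by_contra hsr
  push Not at hsr
  rw [one_mul, one_mul] at hsr
  have h0 : 0 < s + r := by linarith
  apply hn
  have h3 : (s / (s + r)) • ω₁ + (r / (s + r)) • ω₂ ∈ A :=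
    hA.convex h₁ h₂ (by positivity) (by positivity) (by field_simp)
  have h4 := hA.smul_mem _ hsr _ h3
  rw [smul_add, smul_smul, smul_smul, mul_div_cancel₀ _ h0.ne', mul_div_cancel₀ _ h0.ne'] at h4
  exact h4

theorem volume_sector_le (hA : Conoid A f) (h₁ : ω₁ ∈ A) (h₂ : ω₂ ∈ A) :
    volume (sector A ω₁ ω₂) ≤ ENNReal.ofReal (|cross ω₁ ω₂| / 2) := by
  have h := volume_triangle one_pos one_pos ω₁ ω₂
  rw [mul_one, mul_one] at h
  rw [← h]
  exact measure_mono (hA.sector_subset h₁ h₂)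

theorem volume_sector_ne_top (hA : Conoid A f) (h₁ : ω₁ ∈ A) (h₂ : ω₂ ∈ A) :
    volume (sector A ω₁ ω₂) ≠ ⊤ :=
  ne_top_of_le_ne_top ENNReal.ofReal_ne_top (hA.volume_sector_le h₁ h₂)

theorem abs_angle_le (hA : Conoid A f) (h₁ : ω₁ ∈ A) (h₂ : ω₂ ∈ A) :
    |angle A ω₁ ω₂| ≤ |cross ω₁ ω₂| := by
  have h := ENNReal.toReal_mono ENNReal.ofReal_ne_top (hA.volume_sector_le h₁ h₂)
  rw [ENNReal.toReal_ofReal (by positivity)] at h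
  have h' : 0 ≤ (volume (sector A ω₁ ω₂)).toReal := ENNReal.toReal_nonneg
  have hs : |Real.sign (ω₁.1 * ω₂.2 - ω₁.2 * ω₂.1)| ≤ 1 := by
    rcases Real.sign_apply_eq (ω₁.1 * ω₂.2 - ω₁.2 * ω₂.1) with h | h | h <;> rw [h] <;> norm_num
  unfold angle
  rw [abs_mul, abs_of_nonneg (show 0 ≤ 2 * (volume (sector A ω₁ ω₂)).toReal by positivity)]
  calc _ ≤ 1 * (2 * (volume (sector A ω₁ ω₂)).toReal) := by gcongr
    _ ≤ |cross ω₁ ω₂| := by linarith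

theorem le_volume_sector (hA : Conoid A f) (h₁ : ω₁ ∈ A) (h₂ : ω₂ ∈ A) {α β : ℝ} (hα : 0 < α)
    (hβ : 0 < β) (hd : ∀ s r : ℝ, 0 ≤ s → 0 ≤ r → α * s + β * r < 1 → s • ω₁ + r • ω₂ ∉ A) :
    |cross ω₁ ω₂| / (2 * (α * β)) ≤ (volume (sector A ω₁ ω₂)).toReal := by
  rw [← ENNReal.ofReal_le_iff_le_toReal (hA.volume_sector_ne_top h₁ h₂),
    ← volume_triangle hα hβ]
  refine measure_mono ?_
  rintro _ ⟨s, r, hs, hr, hsr, rfl⟩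
  exact ⟨⟨s, r, hs, hr, rfl⟩, hd s r hs hr hsr⟩

/-- The angle lies between `cross ω₁ ω₂ / (α β)` and `cross ω₁ ω₂`. -/
theorem abs_angle_sub_cross_le (hA : Conoid A f) (h₁ : ω₁ ∈ A) (h₂ : ω₂ ∈ A) {α : ℝ} (hα : 1 ≤ α)
    (hd : ∀ s r : ℝ, 0 ≤ s → 0 ≤ r → α * s + r < 1 → s • ω₁ + r • ω₂ ∉ A) :
    |angle A ω₁ ω₂ - cross ω₁ ω₂| ≤ |cross ω₁ ω₂| * (1 - 1 / α) := by
  have h3 := ENNReal.toReal_mono ENNReal.ofReal_ne_top (hA.volume_sector_le h₁ h₂)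
  rw [ENNReal.toReal_ofReal (by positivity)] at h3
  have h4 := hA.le_volume_sector h₁ h₂ (zero_lt_one.trans_le hα) one_pos
    (by simpa only [one_mul] using hd)
  have h5 : |cross ω₁ ω₂| / (2 * (α * 1)) = |cross ω₁ ω₂| * (1 / α) / 2 := by field_simp
  rw [h5] at h4
  unfold angle
  change |Real.sign (cross ω₁ ω₂) * _ - _| ≤ _
  rcases lt_trichotomy (cross ω₁ ω₂) 0 with h | h | h
  · rw [Real.sign_of_neg h]
    rw [abs_of_neg h] at *
    rw [abs_le]
    constructor <;> linarith
  · simp [h]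
  · rw [Real.sign_of_pos h]
    rw [abs_of_pos h] at *
    rw [abs_le]
    constructor <;> linarith

/-- After division by `pair f y * pair f z` this says that the difference of two slopes has the sign
of the cross product. -/
theorem cross_mul_pair (f x y z : ℝ × ℝ) :
    cross x z * pair f y - cross x y * pair f z = pair f x * cross y z := by
  unfold cross pair; ring

/-- The angle is a positive multiple of the cross product; it vanishes only for collinear vectors. -/
theorem angle_eq_pos_mul_cross (hA : Conoid A f) (h₁ : ω₁ ∈ A) (h₂ : ω₂ ∈ A) :
    ∃ k : ℝ, 0 < k ∧ angle A ω₁ ω₂ = k * cross ω₁ ω₂ := by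
  rcases eq_or_ne (cross ω₁ ω₂) 0 with h | h
  · refine ⟨1, one_pos, ?_⟩
    unfold angle
    change Real.sign (cross ω₁ ω₂) * _ = _
    simp [h]
  · have h0 : (0 : ℝ × ℝ) ∈ Aᶜ := fun h => by simpa [pair] using hA.pos _ h
    obtain ⟨ε, hε, hb⟩ := Metric.isOpen_iff.1 hA.closed.isOpen_compl _ h0
    -- A ball of radius `ε` about the origin misses `A`; `M` is so large that the triangle `M s + M
    -- r < 1` lies in the ball. The summand 1 keeps `M` positive.
    set M := (‖ω₁‖ + ‖ω₂‖ + 1) / ε with hM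
    have hMp : 0 < M := by positivity
    have h4 := hA.le_volume_sector h₁ h₂ hMp hMp (by
      intro s r hs hr hsr
      apply hb
      rw [mem_ball_zero_iff]
      have hsr' : (s + r) * (‖ω₁‖ + ‖ω₂‖ + 1) < ε := by
        have : (M * s + M * r) * ε < 1 * ε := by gcongr
        rw [hM] at this
        field_simp at this
        linarith
      calc ‖s • ω₁ + r • ω₂‖ ≤ ‖s • ω₁‖ + ‖r • ω₂‖ := norm_add_le _ _
        _ = s * ‖ω₁‖ + r * ‖ω₂‖ := by
          rw [norm_smul, norm_smul, Real.norm_of_nonneg hs, Real.norm_of_nonneg hr]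
        _ ≤ (s + r) * (‖ω₁‖ + ‖ω₂‖ + 1) := by
          nlinarith [norm_nonneg ω₁, norm_nonneg ω₂, mul_nonneg hs (norm_nonneg ω₂),
            mul_nonneg hr (norm_nonneg ω₁)]
        _ < ε := hsr')
    have hV : 0 < (volume (sector A ω₁ ω₂)).toReal :=
      lt_of_lt_of_le (by have := abs_pos.2 h; positivity) h4
    refine ⟨2 * (volume (sector A ω₁ ω₂)).toReal / |cross ω₁ ω₂|,
      by have := abs_pos.2 h; positivity, ?_⟩
    unfold angle
    change Real.sign (cross ω₁ ω₂) * _ = _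
    rcases lt_or_gt_of_ne h with h | h
    · rw [Real.sign_of_neg h, abs_of_neg h]; field_simp
    · rw [Real.sign_of_pos h, abs_of_pos h]; field_simp

/-- The slope of a direction, a monotone function of the polar angle. -/
noncomputable def slope (f ω₀ z : ℝ × ℝ) : ℝ := cross ω₀ z / pair f z

theorem slope_le_iff {x y : ℝ × ℝ} (h₀ : 0 < pair f ω₀) (hx : 0 < pair f x) (hy : 0 < pair f y) :
    slope f ω₀ x ≤ slope f ω₀ y ↔ 0 ≤ cross x y := by
  have h := cross_mul_pair f ω₀ x y
  unfold slope
  rw [div_le_div_iff₀ hx hy, ← sub_nonneg, h]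
  exact mul_nonneg_iff_of_pos_left h₀

theorem slope_lt_iff {x y : ℝ × ℝ} (h₀ : 0 < pair f ω₀) (hx : 0 < pair f x) (hy : 0 < pair f y) :
    slope f ω₀ x < slope f ω₀ y ↔ 0 < cross x y := by
  have h := cross_mul_pair f ω₀ x y
  unfold slope
  rw [div_lt_div_iff₀ hx hy, ← sub_pos, h]
  exact mul_pos_iff_of_pos_left h₀

theorem volume_cross_eq_zero {x : ℝ × ℝ} (hx : x ≠ 0) : volume {z | cross x z = 0} = 0 := by
  let L : (ℝ × ℝ) →ₗ[ℝ] ℝ :=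
    { toFun := fun z => cross x z
      map_add' := fun a b => by simp [cross]; ring
      map_smul' := fun c a => by simp [cross]; ring }
  have hL : LinearMap.ker L ≠ ⊤ := by
    intro h
    have h1 : L (-x.2, x.1) = 0 := by
      rw [← LinearMap.mem_ker, h]; trivial
    change x.1 * x.1 - x.2 * -x.2 = 0 at h1
    apply hx
    exact Prod.ext (by nlinarith [sq_nonneg x.1, sq_nonneg x.2] : x.1 = 0)
      (by nlinarith [sq_nonneg x.1, sq_nonneg x.2] : x.2 = 0)
  exact Measure.addHaar_submodule volume _ hL

/-- The distribution of the slope on the part of the half-plane that `A` cuts off. -/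
noncomputable def slopeMeasure (A : Set (ℝ × ℝ)) (f ω₀ : ℝ × ℝ) : Measure ℝ :=
  (volume.restrict ({z | 0 < pair f z} \ A)).map (slope f ω₀)

theorem measurable_pair (f : ℝ × ℝ) : Measurable (pair f) := by
  unfold pair; fun_prop

theorem measurable_slope (f ω₀ : ℝ × ℝ) : Measurable (slope f ω₀) := by
  unfold slope cross pair; fun_prop

/-- The sector is the part of the cut-off region with slope between the two end slopes, up to the
ray through `ω₁`, which the half-open interval omits and which has area zero. -/
theorem slopeMeasure_Ioc (hA : Conoid A f) (h₀ : ω₀ ∈ A) (h₁ : ω₁ ∈ A) (h₂ : ω₂ ∈ A)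
    (h : 0 < cross ω₁ ω₂) :
    slopeMeasure A f ω₀ (Ioc (slope f ω₀ ω₁) (slope f ω₀ ω₂)) = volume (sector A ω₁ ω₂) := by
  have p₀ := hA.pos _ h₀
  have p₁ := hA.pos _ h₁
  have p₂ := hA.pos _ h₂
  have hω₁ : ω₁ ≠ 0 := by rintro rfl; simp [pair] at p₁
  have hmeas : MeasurableSet ({z | 0 < pair f z} \ A) :=
    (measurableSet_lt measurable_const (measurable_pair f)).diff hA.closed.measurableSet
  unfold slopeMeasure
  rw [Measure.map_apply (measurable_slope f ω₀) measurableSet_Ioc,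
    Measure.restrict_apply (measurable_slope f ω₀ measurableSet_Ioc)]
  apply le_antisymm
  · refine measure_mono ?_
    rintro z ⟨⟨hz1, hz2⟩, hz3, hz4⟩
    refine ⟨?_, hz4⟩
    rw [slope_lt_iff p₀ p₁ hz3] at hz1
    rw [slope_le_iff p₀ hz3 p₂] at hz2
    exact ⟨_, _, by positivity, by positivity, eq_cross_combo h.ne' z⟩
  · have hsub : sector A ω₁ ω₂ ⊆ (slope f ω₀ ⁻¹' Ioc (slope f ω₀ ω₁) (slope f ω₀ ω₂) ∩
        ({z | 0 < pair f z} \ A)) ∪ {z | cross ω₁ z = 0} := by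
      rintro _ ⟨⟨s, r, hs, hr, rfl⟩, hn⟩
      have hc1 : cross ω₁ (s • ω₁ + r • ω₂) = r * cross ω₁ ω₂ := by simp [cross]; ring
      have hc2 : cross (s • ω₁ + r • ω₂) ω₂ = s * cross ω₁ ω₂ := by simp [cross]; ring
      rcases hr.eq_or_lt with rfl | hr
      · right
        rw [mem_ofPred_eq, hc1, zero_mul]
      · left
        have hp : 0 < pair f (s • ω₁ + r • ω₂) := by
          rw [pair_add, pair_smul, pair_smul]; positivity
        refine ⟨⟨?_, ?_⟩, hp, hn⟩
        · rw [slope_lt_iff p₀ p₁ hp, hc1]; positivity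
        · rw [slope_le_iff p₀ hp p₂, hc2]; positivity
    refine (measure_mono hsub).trans ((measure_union_le _ _).trans ?_)
    rw [volume_cross_eq_zero hω₁, add_zero]

/-- The measure need not be locally finite on the line, so finiteness is secured only between slopes
of points of `A`. -/
theorem slopeMeasure_Ioc_ne_top (hA : Conoid A f) (h₀ : ω₀ ∈ A) (h₁ : ω₁ ∈ A) (h₂ : ω₂ ∈ A) :
    slopeMeasure A f ω₀ (Ioc (slope f ω₀ ω₁) (slope f ω₀ ω₂)) ≠ ⊤ := by
  rcases lt_or_ge 0 (cross ω₁ ω₂) with h | h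
  · rw [hA.slopeMeasure_Ioc h₀ h₁ h₂ h]
    exact hA.volume_sector_ne_top h₁ h₂
  · rw [← not_lt, ← slope_lt_iff (hA.pos _ h₀) (hA.pos _ h₁) (hA.pos _ h₂)] at h
    rw [Ioc_eq_empty h, measure_empty]
    exact ENNReal.zero_ne_top

/-- An interval integral changes sign with its orientation exactly as the angle does, so additivity
holds for every mutual position of three points without a case distinction. -/
theorem angle_eq_integral (hA : Conoid A f) (h₀ : ω₀ ∈ A) (h₁ : ω₁ ∈ A) (h₂ : ω₂ ∈ A) :
    angle A ω₁ ω₂ = ∫ _ in (slope f ω₀ ω₁)..(slope f ω₀ ω₂), (2 : ℝ) ∂(slopeMeasure A f ω₀) := by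
  have key : ∀ x ∈ A, ∀ y ∈ A, 0 < cross x y →
      angle A x y = ∫ _ in (slope f ω₀ x)..(slope f ω₀ y), (2 : ℝ) ∂(slopeMeasure A f ω₀) := by
    intro x hx y hy h
    have hlt := (slope_lt_iff (hA.pos _ h₀) (hA.pos _ hx) (hA.pos _ hy)).2 h
    rw [intervalIntegral.integral_of_le hlt.le, setIntegral_const, measureReal_def,
      hA.slopeMeasure_Ioc h₀ hx hy h]
    unfold angle
    change Real.sign (cross x y) * _ = _
    rw [Real.sign_of_pos h, smul_eq_mul]
    ring
  rcases lt_trichotomy (cross ω₁ ω₂) 0 with h | h | h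
  · have h' : 0 < cross ω₂ ω₁ := by unfold cross at *; linarith
    rw [angle_comm, key _ h₂ _ h₁ h', intervalIntegral.integral_symm, neg_neg]
  · have h' : cross ω₂ ω₁ = 0 := by unfold cross at *; linarith
    have he : slope f ω₀ ω₁ = slope f ω₀ ω₂ :=
      le_antisymm ((slope_le_iff (hA.pos _ h₀) (hA.pos _ h₁) (hA.pos _ h₂)).2 h.ge)
        ((slope_le_iff (hA.pos _ h₀) (hA.pos _ h₂) (hA.pos _ h₁)).2 h'.ge)
    rw [he, intervalIntegral.integral_same]
    unfold angle
    change Real.sign (cross ω₁ ω₂) * _ = _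
    simp [h]
  · exact key _ h₁ _ h₂ h

theorem angle_add (hA : Conoid A f) (h₀ : ω₀ ∈ A) (h₁ : ω₁ ∈ A) (h₂ : ω₂ ∈ A) :
    angle A ω₀ ω₁ + angle A ω₁ ω₂ = angle A ω₀ ω₂ := by
  have hint : ∀ x ∈ A, ∀ y ∈ A, IntervalIntegrable (fun _ => (2 : ℝ)) (slopeMeasure A f ω₀)
      (slope f ω₀ x) (slope f ω₀ y) := by
    intro x hx y hy
    exact ⟨integrableOn_const (hA.slopeMeasure_Ioc_ne_top h₀ hx hy),
      integrableOn_const (hA.slopeMeasure_Ioc_ne_top h₀ hy hx)⟩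
  rw [hA.angle_eq_integral h₀ h₀ h₁, hA.angle_eq_integral h₀ h₁ h₂,
    hA.angle_eq_integral h₀ h₀ h₂]
  exact intervalIntegral.integral_add_adjacent_intervals (hint _ h₀ _ h₁) (hint _ h₁ _ h₂)

end Conoid

end LorentzAff

namespace LorentzAff

variable {Ω l₀ l₁ : Set (ℝ × ℝ)} {v w : ℝ × ℝ}

/-! ### The antipolar set -/

theorem mem_antipolar_iff {π : ℝ × ℝ} :
    π ∈ antipolar Ω ↔ ∀ ω ∈ Ω, 1 ≤ pair (π.1, -π.2) ω := by
  simp only [antipolar, pair, mem_ofPred_eq, neg_mul, sub_eq_add_neg]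

theorem conoid_antipolar {e : ℝ × ℝ} (he : e ∈ Ω) : Conoid (antipolar Ω) (e.1, -e.2) where
  convex := by
    intro x hx y hy a b ha hb hab ω hω
    have h1 := mul_le_mul_of_nonneg_left (hx ω hω) ha
    have h2 := mul_le_mul_of_nonneg_left (hy ω hω) hb
    simp only [Prod.fst_add, Prod.snd_add, Prod.smul_fst, Prod.smul_snd, smul_eq_mul]
    linarith
  closed := by
    have : antipolar Ω = ⋂ ω ∈ Ω, {π : ℝ × ℝ | 1 ≤ π.1 * ω.1 - π.2 * ω.2} := by
      ext π; simp [antipolar]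
    rw [this]
    refine isClosed_biInter fun ω _ => isClosed_le continuous_const (by fun_prop)
  smul_mem := by
    intro c hc z hz ω hω
    have h1 := hz ω hω
    simp only [Prod.smul_fst, Prod.smul_snd, smul_eq_mul]
    nlinarith
  pos := by
    intro z hz
    have := hz e he
    simp only [pair]
    linarith

/-- A covector that is at least one on `Ω` is bounded below by a multiple of the norm on `C`. -/
theorem Frame.exists_pair_ge (F : Frame Ω l₀ l₁ v w) (hSS : PropStarStar Ω l₀ l₁)
    {h : ℝ × ℝ} (hh : ∀ ω ∈ Ω, 1 ≤ pair h ω) :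
    ∃ δ : ℝ, 0 < δ ∧ ∀ z ∈ cone Ω, δ * ‖z‖ ≤ pair h z := by
  have hnn : ∀ z ∈ cone Ω, 0 ≤ pair h z := by
    intro z hz
    have hc : IsClosed {z | 0 ≤ pair h z} := isClosed_le continuous_const (by unfold pair; fun_prop)
    refine closure_minimal (fun y hy => ?_) hc hz
    obtain ⟨c, hc, ω, hω, rfl⟩ := PropI.mem_rayHull_iff.1 hy
    rw [mem_ofPred_eq, pair_smul]
    have := hh ω hω
    positivity
  -- A covector that vanishes on a ray at distance zero from `Ω` takes values below 1 on `Ω`; hence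
  -- strict positivity on the extreme rays.
  have hpos : ∀ x ∈ cone Ω, ⨅ y ∈ rayOf x, Metric.infEDist y Ω = 0 → 0 < pair h x := by
    intro x hx hd
    refine lt_of_le_of_ne (hnn x hx) fun h0 => ?_
    obtain ⟨ω, hω, h1⟩ := exists_small_pair hd (h := h)
      (by rintro _ ⟨k, -, rfl⟩; rw [pair_smul, ← h0, mul_zero]) one_pos
    rw [abs_lt] at h1
    linarith [hh ω hω]
  have ha := hpos v F.left_mem (F.ray₀ ▸ hSS.dist₀)
  have hb := hpos w F.right_mem (F.ray₁ ▸ hSS.dist₁)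
  have hv := norm_nonneg v
  have hw := norm_nonneg w
  refine ⟨min (pair h v / (‖v‖ + 1)) (pair h w / (‖w‖ + 1)), by positivity, ?_⟩
  intro z hz
  rw [F.cone_eq] at hz
  obtain ⟨s, r, hs, hr, rfl⟩ := hz
  set δ := min (pair h v / (‖v‖ + 1)) (pair h w / (‖w‖ + 1)) with hδ
  have hδ0 : 0 < δ := by positivity
  have h1 : δ * (‖v‖ + 1) ≤ pair h v := (le_div_iff₀ (by positivity)).1 (min_le_left _ _)
  have h2 : δ * (‖w‖ + 1) ≤ pair h w := (le_div_iff₀ (by positivity)).1 (min_le_right _ _)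
  have h3 : ‖s • v + r • w‖ ≤ s * ‖v‖ + r * ‖w‖ := by
    refine (norm_add_le _ _).trans_eq ?_
    rw [norm_smul, norm_smul, Real.norm_of_nonneg hs, Real.norm_of_nonneg hr]
  rw [pair_add, pair_smul, pair_smul]
  calc δ * ‖s • v + r • w‖ ≤ δ * (s * ‖v‖ + r * ‖w‖) := by gcongr
    _ = s * (δ * ‖v‖) + r * (δ * ‖w‖) := by ring
    _ ≤ s * pair h v + r * pair h w := by gcongr <;> linarith

/-- Passing from `π` to `c π` gains `(c - 1) ⟨π, ω⟩ ≥ (c - 1) δ ‖ω‖` in the constraint given by `ω`.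
The gain grows with `‖ω‖`, so one perturbation size serves all `ω` of the unbounded set `Ω`. -/
theorem smul_mem_interior_antipolar (F : Frame Ω l₀ l₁ v w)
    (hSS : PropStarStar Ω l₀ l₁) {π : ℝ × ℝ} (hπ : π ∈ antipolar Ω) {c : ℝ} (hc : 1 < c) :
    c • π ∈ interior (antipolar Ω) := by
  obtain ⟨δ, hδ, hb⟩ := F.exists_pair_ge hSS (mem_antipolar_iff.1 hπ)
  have hε : 0 < (c - 1) * δ / 2 := by
    have : 0 < c - 1 := by linarith
    positivity
  rw [mem_interior_iff_mem_nhds, Metric.mem_nhds_iff]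
  -- The factor 1/2 pays for the two coordinates in `abs_pair_le`.
  refine ⟨(c - 1) * δ / 2, hε, fun y hy => ?_⟩
  rw [mem_ball_iff_norm] at hy
  rw [mem_antipolar_iff]
  intro ω hω
  have h1 := hb ω (PropI.subset_cone hω)
  have h2 := mem_antipolar_iff.1 hπ ω hω
  have h3 := abs_pair_le ((y - c • π).1, -(y - c • π).2) ω
  have h4 : |(y - c • π).1| ≤ ‖y - c • π‖ := norm_fst_le (y - c • π)
  have h5 : |-(y - c • π).2| ≤ ‖y - c • π‖ := by rw [abs_neg]; exact norm_snd_le (y - c • π)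
  have h6 : pair (y.1, -y.2) ω =
      c * pair (π.1, -π.2) ω + pair ((y - c • π).1, -(y - c • π).2) ω := by
    simp [pair]; ring
  have h7 : (|(y - c • π).1| + |-(y - c • π).2|) * ‖ω‖ ≤ (c - 1) * δ * ‖ω‖ := by
    gcongr
    linarith
  have h8 := (abs_le.1 h3).1
  have h9 : (c - 1) * (δ * ‖ω‖) ≤ (c - 1) * pair (π.1, -π.2) ω :=
    mul_le_mul_of_nonneg_left h1 (by linarith)
  dsimp only at h8
  rw [h6]
  nlinarith

theorem frontier_antipolar_subset (hI : PropI Ω) : frontier (antipolar Ω) ⊆ antipolar Ω := by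
  obtain ⟨e, he⟩ := hI.nonempty
  exact (conoid_antipolar he).closed.frontier_subset

/-- Some linear functional is positive on the antipolar set, so collinear points of it are positive
multiples of each other; a factor different from 1 would make one of them interior. -/
theorem eq_of_cross_eq_zero (hI : PropI Ω) (F : Frame Ω l₀ l₁ v w) (hSS : PropStarStar Ω l₀ l₁)
    {x y : ℝ × ℝ} (hx : x ∈ frontier (antipolar Ω)) (hy : y ∈ frontier (antipolar Ω))
    (h : cross x y = 0) : x = y := by
  obtain ⟨e, he⟩ := hI.nonempty
  have hA := conoid_antipolar he
  have hxA := frontier_antipolar_subset hI hx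
  have hyA := frontier_antipolar_subset hI hy
  have px := hA.pos x hxA
  have py := hA.pos y hyA
  set f : ℝ × ℝ := (e.1, -e.2)
  have hyx : y = (pair f y / pair f x) • x := by
    unfold cross at h
    ext
    · simp only [Prod.smul_fst, smul_eq_mul]
      field_simp
      unfold pair
      linear_combination (-f.2) * h
    · simp only [Prod.smul_snd, smul_eq_mul]
      field_simp
      unfold pair
      linear_combination f.1 * h
  set k := pair f y / pair f x with hk
  have hk0 : 0 < k := div_pos py px
  rcases lt_trichotomy k 1 with h1 | h1 | h1
  · exfalso
    have h2 : x = k⁻¹ • y := by rw [hyx, smul_smul, inv_mul_cancel₀ hk0.ne', one_smul]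
    rw [h2] at hx
    exact hx.2 (smul_mem_interior_antipolar F hSS hyA ((one_lt_inv₀ hk0).2 h1))
  · rw [hyx, h1, one_smul]
  · exfalso
    rw [hyx] at hy
    exact hy.2 (smul_mem_interior_antipolar F hSS hxA h1)

theorem injOn_angle (hI : PropI Ω) (F : Frame Ω l₀ l₁ v w) (hSS : PropStarStar Ω l₀ l₁)
    {ω₀ : ℝ × ℝ} (hω₀ : ω₀ ∈ frontier (antipolar Ω)) :
    InjOn (angle (antipolar Ω) ω₀) (frontier (antipolar Ω)) := by
  obtain ⟨e, he⟩ := hI.nonempty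
  have hA := conoid_antipolar he
  have hsub := frontier_antipolar_subset hI
  intro x hx y hy hxy
  refine eq_of_cross_eq_zero hI F hSS hx hy ?_
  have h1 := hA.angle_add (hsub hω₀) (hsub hx) (hsub hy)
  obtain ⟨k, hk, h2⟩ := hA.angle_eq_pos_mul_cross (hsub hx) (hsub hy)
  have h3 : k * cross x y = 0 := by linarith
  exact (mul_eq_zero.1 h3).resolve_left hk.ne'

theorem boundaryPoint_angle (hI : PropI Ω) (F : Frame Ω l₀ l₁ v w) (hSS : PropStarStar Ω l₀ l₁)
    {ω₀ : ℝ × ℝ} (hω₀ : ω₀ ∈ frontier (antipolar Ω)) {x : ℝ × ℝ}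
    (hx : x ∈ frontier (antipolar Ω)) :
    boundaryPoint (antipolar Ω) ω₀ (angle (antipolar Ω) ω₀ x) = x :=
  (injOn_angle hI F hSS hω₀).leftInvOn_invFunOn hx

/-! ### Curves on the boundary of the antipolar set -/

theorem abs_cross_le (x y : ℝ × ℝ) : |cross x y| ≤ 2 * ‖x‖ * ‖y - x‖ := by
  have h1 : cross x y = pair (-x.2, x.1) (y - x) := by simp [cross, pair]; ring
  rw [h1]
  refine (abs_pair_le _ _).trans ?_
  have h2 : |x.1| ≤ ‖x‖ := norm_fst_le x
  have h3 : |x.2| ≤ ‖x‖ := norm_snd_le x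
  gcongr
  simp only [abs_neg]
  linarith

/-- The derivative of the angle along a curve is `cross π π'` at each time at which the curve is
differentiable and the boundary has a supporting line with a conormal in `Ω`. -/
theorem hasDerivAt_angle (hI : PropI Ω) {ω₀ : ℝ × ℝ} (hω₀ : ω₀ ∈ antipolar Ω)
    {π : ℝ → ℝ × ℝ} {d y : ℝ × ℝ} {t : ℝ} (hmem : ∀ᶠ s in 𝓝 t, π s ∈ antipolar Ω)
    (h1 : HasDerivAt (fun s => (π s).1) d.1 t) (h2 : HasDerivAt (fun s => (π s).2) d.2 t)
    (hy : y ∈ Ω) (hyt : pair ((π t).1, -(π t).2) y = 1) :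
    HasDerivAt (fun s => angle (antipolar Ω) ω₀ (π s)) (cross (π t) d) t := by
  obtain ⟨e, he⟩ := hI.nonempty
  have hA := conoid_antipolar he
  have hcr : HasDerivAt (fun s => cross (π t) (π s)) (cross (π t) d) t := by
    unfold cross
    exact (h2.const_mul _).sub (h1.const_mul _)
  have hcr0 : cross (π t) (π t) = 0 := by unfold cross; ring
  have hα : ContinuousAt (fun s => pair ((π s).1, -(π s).2) y) t := by
    unfold pair
    exact (h1.continuousAt.mul continuousAt_const).add
      (h2.continuousAt.neg.mul continuousAt_const)
  have hlim : Tendsto (fun s => 1 - 1 / pair ((π s).1, -(π s).2) y) (𝓝 t) (𝓝 0) := by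
    have h3 : ContinuousAt (fun s => 1 - 1 / pair ((π s).1, -(π s).2) y) t :=
      continuousAt_const.sub (continuousAt_const.div hα (by rw [hyt]; exact one_ne_zero))
    have h4 := h3.tendsto
    rw [hyt] at h4
    simpa using h4
  have hO : (fun s => cross (π t) (π s)) =O[𝓝 t] fun s => s - t := by
    simpa [hcr0] using hcr.differentiableAt.isBigO_sub
  have ho : (fun s => cross (π t) (π s) * (1 - 1 / pair ((π s).1, -(π s).2) y)) =o[𝓝 t]
      fun s => s - t := by
    simpa using hO.mul_isLittleO ((Asymptotics.isLittleO_one_iff ℝ).2 hlim)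
  -- The angle between `π s` and `π t` differs from their cross product by at most `|cross| (1 -
  -- 1/α)` with `α = ⟨π s, y⟩`. The first factor is `O(s - t)`, and `α` tends to 1.
  have hg : HasDerivAt (fun s => angle (antipolar Ω) ω₀ (π s) - cross (π t) (π s)) 0 t := by
    rw [hasDerivAt_iff_isLittleO]
    refine (Asymptotics.IsBigO.of_bound 1 ?_).trans_isLittleO ho
    filter_upwards [hmem] with s hs
    have ht := hmem.self_of_nhds
    have h3 := hA.angle_add hω₀ hs ht
    -- The triangle inside the sector is cut off by the supporting line that `y` defines at `π t`;
    -- beyond this line, towards the origin, there are no points of the antipolar set.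
    have h4 := hA.abs_angle_sub_cross_le hs ht
      (α := pair ((π s).1, -(π s).2) y) (mem_antipolar_iff.1 hs y hy) (by
        intro σ r hσ hr hlt hmemA
        have h5 := mem_antipolar_iff.1 hmemA y hy
        have h6 : pair ((σ • π s + r • π t).1, -(σ • π s + r • π t).2) y =
            σ * pair ((π s).1, -(π s).2) y + r * pair ((π t).1, -(π t).2) y := by
          simp [pair]; ring
        rw [h6, hyt] at h5
        linarith)
    have h5 : cross (π s) (π t) = -cross (π t) (π s) := by unfold cross; ring
    have h6 : 1 ≤ pair ((π s).1, -(π s).2) y := mem_antipolar_iff.1 hs y hy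
    have h7 : 0 ≤ 1 - 1 / pair ((π s).1, -(π s).2) y := by
      rw [sub_nonneg, div_le_one (by linarith)]; exact h6
    rw [hcr0, one_mul, norm_mul, Real.norm_eq_abs, Real.norm_eq_abs, Real.norm_eq_abs,
      abs_of_nonneg h7]
    rw [h5, abs_neg] at h4
    refine le_trans (le_of_eq ?_) h4
    rw [← abs_neg]
    congr 1
    simp only [smul_zero]
    linarith
  have h3 := hg.add hcr
  rw [zero_add] at h3
  exact h3.congr_of_eventuallyEq (Eventually.of_forall fun s => (sub_add_cancel _ _).symm)

/-- A curve on the boundary of the antipolar set whose sectorial velocity is its first coordinate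
almost everywhere is parametrised by `cosh` and `sinh` of its angle. -/
theorem hasDerivAt_angle_of_ae (hI : PropI Ω) {ω₀ : ℝ × ℝ} (hω₀ : ω₀ ∈ antipolar Ω)
    {T : ℝ} (hT : 0 < T) {π : ℝ → ℝ × ℝ} {K : NNReal} (hπ : LipschitzOnWith K π (Icc 0 T))
    (hmem : ∀ t ∈ Icc 0 T, π t ∈ antipolar Ω)
    (hd : ∀ᵐ t ∂volume.restrict (Icc 0 T),
      HasDerivAt (fun s => angle (antipolar Ω) ω₀ (π s)) (π t).1 t) :
    ∃ f g : ℝ → ℝ, (∀ t, HasDerivAt f (g t) t) ∧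
      ∀ t ∈ Icc 0 T, g t = (π t).1 ∧ f t = angle (antipolar Ω) ω₀ (π t) := by
  obtain ⟨e, he⟩ := hI.nonempty
  have hA := conoid_antipolar he
  set η := fun s => angle (antipolar Ω) ω₀ (π s) with hη
  have hcont : ContinuousOn π (Icc 0 T) := hπ.continuousOn
  obtain ⟨M, hM⟩ := isCompact_Icc.exists_bound_of_continuousOn hcont
  have hM0 : 0 ≤ M := (norm_nonneg _).trans (hM 0 ⟨le_rfl, hT.le⟩)
  -- By additivity the increment of the angle is the angle between two points of the curve, at most
  -- their cross product.
  have hlip : LipschitzOnWith (2 * M.toNNReal * K) η (uIcc 0 T) := by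
    rw [uIcc_of_le hT.le]
    refine LipschitzOnWith.of_dist_le_mul fun s hs t ht => ?_
    have h1 := hA.angle_add hω₀ (hmem s hs) (hmem t ht)
    have h2 := hA.abs_angle_le (hmem s hs) (hmem t ht)
    have h3 := hπ.dist_le_mul t ht s hs
    rw [dist_comm, Real.dist_eq]
    calc |η t - η s| = |angle (antipolar Ω) (π s) (π t)| := by
          congr 1; simp only [hη]; linarith
      _ ≤ 2 * ‖π s‖ * ‖π t - π s‖ := h2.trans (abs_cross_le _ _)
      _ ≤ 2 * M * (K * dist t s) := by
          rw [← dist_eq_norm]; gcongr; exact hM s hs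
      _ = _ := by
          rw [dist_comm t s]; push_cast; rw [Real.coe_toNNReal _ hM0]; ring
  -- Continued by constants beyond the interval, so that the primitive is differentiable on the
  -- whole line, end points included.
  set g : ℝ → ℝ := IccExtend hT.le ((Icc 0 T).domRestrict fun t => (π t).1) with hg
  have hgc : Continuous g := (continuousOn_iff_continuous_domRestrict.1 hcont.fst).Icc_extend'
  have hgI : ∀ t ∈ Icc 0 T, g t = (π t).1 := fun t ht => IccExtend_of_mem hT.le _ ht
  have hG : ∀ t, HasDerivAt (fun t => ∫ s in (0 : ℝ)..t, g s) (g t) t := fun t =>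
    (hgc.integral_hasStrictDerivAt 0 t).hasDerivAt
  refine ⟨fun t => η 0 + ∫ s in (0 : ℝ)..t, g s, g, fun t => ?_, fun t ht => ⟨hgI t ht, ?_⟩⟩
  · simpa using (hG t).const_add (η 0)
  · have hac : AbsolutelyContinuousOnInterval (fun t => η t - ∫ s in (0 : ℝ)..t, g s) 0 T :=
      hlip.absolutelyContinuousOnInterval.fun_sub
        ((hgc.intervalIntegrable 0 T).absolutelyContinuousOnInterval_intervalIntegral (by simp))
    have h0 : ∀ᵐ t ∂volume.restrict (Icc 0 T),
        HasDerivAt (fun t => η t - ∫ s in (0 : ℝ)..t, g s) 0 t := by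
      filter_upwards [hd, ae_restrict_mem measurableSet_Icc] with t h1 h2
      have h3 := h1.sub (hG t)
      rw [hgI t h2, sub_self] at h3
      exact h3
    have h1 := eq_of_ae_hasDerivAt_zero hT.le hac h0 ht
    rw [intervalIntegral.integral_same, sub_zero] at h1
    simp only [hη] at h1 ⊢
    linarith

/-- Separation of variables in `f' = c ∘ f` with `c ∘ f` of constant sign. -/
theorem integral_one_div_of_hasDerivAt {f g c : ℝ → ℝ} {T : ℝ} (hf : ∀ t, HasDerivAt f (g t) t)
    (hc : ∀ t ∈ Icc 0 T, c (f t) = g t) (hne : ∀ t ∈ Icc 0 T, g t ≠ 0)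
    (hsign : (∀ t ∈ Icc 0 T, 0 ≤ g t) ∨ ∀ t ∈ Icc 0 T, g t ≤ 0) {t : ℝ} (ht : t ∈ Icc 0 T) :
    IntervalIntegrable (fun s => 1 / c s) volume (f 0) (f t) ∧
      t = ∫ s in (f 0)..(f t), 1 / c s := by
  have hcont : ContinuousOn f (uIcc 0 t) := fun x _ => (hf x).continuousAt.continuousWithinAt
  have hsub : Ioo (min 0 t) (max 0 t) ⊆ Icc 0 T := by
    rw [min_eq_left ht.1, max_eq_right ht.1]
    exact fun x hx => ⟨hx.1.le, hx.2.le.trans ht.2⟩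
  have hone : ∀ x ∈ uIoc 0 t, ((fun s => 1 / c s) ∘ f) x * g x = 1 := by
    intro x hx
    rw [uIoc_of_le ht.1] at hx
    have hx' : x ∈ Icc 0 T := ⟨hx.1.le, hx.2.trans ht.2⟩
    simp only [Function.comp_apply, hc x hx']
    exact one_div_mul_cancel (hne x hx')
  have hint : IntervalIntegrable (fun x => ((fun s => 1 / c s) ∘ f) x * g x) volume 0 t :=
    (intervalIntegrable_congr fun x hx => hone x hx).2 intervalIntegrable_const
  have hval : ∫ x in (0 : ℝ)..t, ((fun s => 1 / c s) ∘ f) x * g x = t := by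
    rw [intervalIntegral.integral_congr_ae (g := fun _ => (1 : ℝ))
      (Eventually.of_forall fun x hx => hone x hx)]
    simp
  -- The constant sign makes `f` monotone, and the substitution rule for monotone `f` needs no
  -- regularity of `c`, which is known only along `f`.
  rcases hsign with h | h
  · have h1 := intervalIntegral.integrable_comp_mul_deriv_iff_of_deriv_nonneg
      (g := fun s => 1 / c s) hcont (fun x _ => hf x) (fun x hx => h x (hsub hx))
    have h2 := intervalIntegral.integral_comp_mul_deriv_of_deriv_nonneg
      (g := fun s => 1 / c s) hcont (fun x _ => hf x) (fun x hx => h x (hsub hx))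
    exact ⟨h1.1 hint, by rw [← h2, hval]⟩
  · have h1 := intervalIntegral.integrable_comp_mul_deriv_iff_of_deriv_nonpos
      (g := fun s => 1 / c s) hcont (fun x _ => hf x) (fun x hx => h x (hsub hx))
    have h2 := intervalIntegral.integral_comp_mul_deriv_of_deriv_nonpos
      (g := fun s => 1 / c s) hcont (fun x _ => hf x) (fun x hx => h x (hsub hx))
    exact ⟨h1.1 hint, by rw [← h2, hval]⟩

end LorentzAff

namespace LorentzAff

variable {Ω l₀ l₁ : Set (ℝ × ℝ)} {v w : ℝ × ℝ} {T lam : ℝ} {q p u : ℝ → ℝ × ℝ}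

/-! ### Timelike extremals -/

/-- The components of the momentum are affine functions of the point of the curve. -/
theorem IsExtremal.exists_momentum_eq (hI : PropI Ω) (E : IsExtremal Ω lam T q p u) :
    ∃ k : ℝ, ∀ t ∈ Icc 0 T, momentum (q t) (p t) =
      ((p 0).1 * (q t).2, k - (p 0).1 * (q t).1) := by
  have hT := E.T_pos.le
  refine ⟨(q 0).2 * (p 0).2 + (p 0).1 * (q 0).1, fun t ht => ?_⟩
  have hac : AbsolutelyContinuousOnInterval
      (fun t => (q t).2 * (p t).2 + (p 0).1 * (q t).1) 0 T :=
    ((ac_snd hT E.q_lipschitz).fun_mul (ac_snd hT E.p_lipschitz)).fun_add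
      ((ac_fst hT E.q_lipschitz).const_mul _)
  -- The first integral: `h₂' = b u₂ p₂ - b ⟨p, u⟩ = -p₁ b u₁ = -p₁ a'`.
  have h0 : ∀ᵐ t ∂volume.restrict (Icc 0 T),
      HasDerivAt (fun t => (q t).2 * (p t).2 + (p 0).1 * (q t).1) 0 t := by
    filter_upwards [E.ae_extremalAt hI] with t h
    have h1 := (h.2.deriv_b.mul h.2.deriv_p₂).add (h.2.deriv_a.const_mul (p 0).1)
    have h2 : (q t).2 * (u t).2 * (p t).2 + (q t).2 * -pair (p t) (u t) +
        (p 0).1 * ((q t).2 * (u t).1) = 0 := by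
      rw [← E.p₁_const hI h.1]
      unfold pair
      ring
    rw [h2] at h1
    exact h1
  have h1 := eq_of_ae_hasDerivAt_zero hT hac h0 ht
  simp only [momentum]
  rw [E.p₁_const hI ht]
  ext
  · simp only; ring
  · simp only at h1 ⊢; linarith

/-- The point of the plane of the antipolar set that corresponds to the momentum. -/
def antipolarPoint (q p : ℝ × ℝ) : ℝ × ℝ := (-(momentum q p).1, (momentum q p).2)

theorem pair_antipolarPoint (q p z : ℝ × ℝ) :
    pair ((antipolarPoint q p).1, -(antipolarPoint q p).2) z = -pair (momentum q p) z := by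
  simp [antipolarPoint, pair]; ring

theorem IsExtremal.lipschitz_antipolarPoint (hI : PropI Ω) (E : IsExtremal Ω lam T q p u) :
    ∃ K : NNReal, LipschitzOnWith K (fun t => antipolarPoint (q t) (p t)) (Icc 0 T) := by
  obtain ⟨k, hk⟩ := E.exists_momentum_eq hI
  obtain ⟨K, hK⟩ := E.q_lipschitz
  refine ⟨‖(p 0).1‖₊ * K, LipschitzOnWith.of_dist_le_mul fun s hs t ht => ?_⟩
  have h := hK.dist_le_mul s hs t ht
  have h1 : |(q s).1 - (q t).1| ≤ dist (q s) (q t) := by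
    rw [← Real.dist_eq, Prod.dist_eq]; exact le_max_left _ _
  have h2 : |(q s).2 - (q t).2| ≤ dist (q s) (q t) := by
    rw [← Real.dist_eq, Prod.dist_eq]; exact le_max_right _ _
  have h3 : dist (antipolarPoint (q s) (p s)) (antipolarPoint (q t) (p t)) ≤
      |(p 0).1| * dist (q s) (q t) := by
    unfold antipolarPoint
    rw [hk s hs, hk t ht, Prod.dist_eq]
    refine max_le ?_ ?_
    · simp only [Real.dist_eq]
      rw [show -((p 0).1 * (q s).2) - -((p 0).1 * (q t).2) =
        -((p 0).1 * ((q s).2 - (q t).2)) by ring, abs_neg, abs_mul]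
      gcongr
    · simp only [Real.dist_eq]
      rw [show k - (p 0).1 * (q s).1 - (k - (p 0).1 * (q t).1) =
        -((p 0).1 * ((q s).1 - (q t).1)) by ring, abs_neg, abs_mul]
      gcongr
  push_cast
  rw [Real.norm_eq_abs, mul_assoc]
  exact h3.trans (by gcongr)

/-- The pointwise description of normal extremals in natural parametrisation. -/
theorem IsExtremal.ae_natural (hI : PropI Ω) (E : IsExtremal Ω (-1) T q p u)
    (hN : IsNatural Ω T u) : ∀ᵐ t ∂volume.restrict (Icc 0 T), u t ∈ Ω ∧
      pair (momentum (q t) (p t)) (u t) = -1 ∧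
      ∀ z ∈ Ω, pair (momentum (q t) (p t)) z ≤ -1 := by
  filter_upwards [E.ae_extremalAt hI, hN] with t h1 h2
  refine ⟨mem_of_antiNorm_eq_one hI h2, ?_, fun z hz => ?_⟩
  · rw [h1.2.pair_eq, nu, h2]
    simp
  · have h3 := h1.2.pair_le z (PropI.subset_cone hz)
    have h4 := one_le_nu hI hz
    linarith

/-- The constraint given by `y` is active, so any shrinking of the point towards the origin violates
it. -/
theorem mem_frontier_antipolar {q p y : ℝ × ℝ} (hy : y ∈ Ω) (h1 : pair (momentum q p) y = -1)
    (h2 : ∀ z ∈ Ω, pair (momentum q p) z ≤ -1) :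
    antipolarPoint q p ∈ frontier (antipolar Ω) := by
  set x := antipolarPoint q p with hx
  refine ⟨subset_closure (mem_antipolar_iff.2 fun z hz => ?_), fun hint => ?_⟩
  · rw [hx, pair_antipolarPoint]
    linarith [h2 z hz]
  · have ht : Tendsto (fun n : ℕ => (1 - (1 : ℝ) / ((n : ℝ) + 1)) • x) atTop (𝓝 x) := by
      have := ((tendsto_one_div_add_atTop_nhds_zero_nat (𝕜 := ℝ)).const_sub 1).smul_const x
      simpa using this
    obtain ⟨n, hn⟩ := (ht.eventually (mem_interior_iff_mem_nhds.1 hint)).exists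
    have h3 := mem_antipolar_iff.1 hn y hy
    have h4 : pair (((1 - (1 : ℝ) / ((n : ℝ) + 1)) • x).1, -((1 - (1 : ℝ) / ((n : ℝ) + 1)) • x).2) y
        = (1 - (1 : ℝ) / ((n : ℝ) + 1)) * pair (x.1, -x.2) y := by
      simp [pair]; ring
    rw [h4, hx, pair_antipolarPoint, h1] at h3
    have : (0 : ℝ) < 1 / ((n : ℝ) + 1) := by positivity
    linarith

theorem IsExtremal.forall_mem_frontier_antipolar (hI : PropI Ω) (E : IsExtremal Ω (-1) T q p u)
    (hN : IsNatural Ω T u) {t : ℝ} (ht : t ∈ Icc 0 T) :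
    antipolarPoint (q t) (p t) ∈ frontier (antipolar Ω) := by
  obtain ⟨K, hK⟩ := E.lipschitz_antipolarPoint hI
  refine forall_mem_of_ae E.T_pos hK.continuousOn isClosed_frontier ?_ ht
  filter_upwards [E.ae_natural hI hN] with t h
  exact mem_frontier_antipolar h.1 h.2.1 h.2.2

theorem IsExtremal.ae_hasDerivAt_angle (hI : PropI Ω) (E : IsExtremal Ω (-1) T q p u)
    (hN : IsNatural Ω T u) {ω₀ : ℝ × ℝ} (hω₀ : ω₀ ∈ antipolar Ω) :
    ∀ᵐ t ∂volume.restrict (Icc 0 T),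
      HasDerivAt (fun s => angle (antipolar Ω) ω₀ (antipolarPoint (q s) (p s)))
        (antipolarPoint (q t) (p t)).1 t := by
  have hIoo : ∀ᵐ t ∂volume.restrict (Icc 0 T), t ∈ Ioo 0 T := by
    rw [← restrict_Ioo_eq_restrict_Icc]
    exact ae_restrict_mem measurableSet_Ioo
  filter_upwards [E.ae_natural hI hN, E.ae_extremalAt hI, hIoo] with t h1 h2 h3
  have hd1 : HasDerivAt (fun s => (antipolarPoint (q s) (p s)).1)
      (-((q t).2 * (u t).2 * (p t).1)) t := by
    have := (h2.2.deriv_b.mul h2.2.deriv_p₁).neg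
    rw [mul_zero, add_zero] at this
    exact this
  have hd2 : HasDerivAt (fun s => (antipolarPoint (q s) (p s)).2)
      ((q t).2 * (u t).2 * (p t).2 + (q t).2 * -pair (p t) (u t)) t :=
    h2.2.deriv_b.mul h2.2.deriv_p₂
  have hmem : ∀ᶠ s in 𝓝 t, antipolarPoint (q s) (p s) ∈ antipolar Ω := by
    filter_upwards [isOpen_Ioo.mem_nhds h3] with s hs
    exact frontier_antipolar_subset hI
      (E.forall_mem_frontier_antipolar hI hN ⟨hs.1.le, hs.2.le⟩)
  -- The control itself is the conormal in `Ω` of a supporting line, by `⟨h, u⟩ = -1`. With this `d`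
  -- the cross product is `b p₁ ⟨h, u⟩ = -b p₁`.
  have h4 := hasDerivAt_angle hI hω₀ (d := (-((q t).2 * (u t).2 * (p t).1),
    (q t).2 * (u t).2 * (p t).2 + (q t).2 * -pair (p t) (u t))) hmem hd1 hd2 h1.1
    (by rw [pair_antipolarPoint, h1.2.1, neg_neg])
  convert h4 using 1
  have h5 := h1.2.1
  simp only [antipolarPoint, cross, momentum, pair] at h5 ⊢
  linear_combination -((q t).2 * (p t).1) * h5

/-- Extremals with a non-zero first component of the momentum. -/
theorem IsExtremal.isTypeA (hI : PropI Ω) (F : Frame Ω l₀ l₁ v w) (hSS : PropStarStar Ω l₀ l₁)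
    (E : IsExtremal Ω (-1) T q p u) (hN : IsNatural Ω T u) {ω₀ : ℝ × ℝ}
    (hω₀ : ω₀ ∈ frontier (antipolar Ω)) (hp : (p 0).1 ≠ 0) : IsTypeA Ω ω₀ T q p := by
  have hT := E.T_pos
  obtain ⟨K, hK⟩ := E.lipschitz_antipolarPoint hI
  obtain ⟨k, hk⟩ := E.exists_momentum_eq hI
  have hfr := fun t ht => E.forall_mem_frontier_antipolar hI hN (t := t) ht
  have hω := frontier_antipolar_subset hI hω₀
  obtain ⟨f, g, hf, hfg⟩ := hasDerivAt_angle_of_ae hI hω hT hK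
    (fun t ht => frontier_antipolar_subset hI (hfr t ht)) (E.ae_hasDerivAt_angle hI hN hω)
  have hbp : ∀ t ∈ Icc 0 T,
      boundaryPoint (antipolar Ω) ω₀ (f t) = antipolarPoint (q t) (p t) := by
    intro t ht
    rw [(hfg t ht).2]
    exact boundaryPoint_angle hI F hSS hω₀ (hfr t ht)
  have hcosh : ∀ t ∈ Icc 0 T, coshO (antipolar Ω) ω₀ (f t) = g t := by
    intro t ht
    rw [coshO, hbp t ht, (hfg t ht).1]
  have hg : ∀ t ∈ Icc 0 T, g t = -((p 0).1 * (q t).2) := by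
    intro t ht
    rw [(hfg t ht).1, antipolarPoint, hk t ht]
  have hg0 : ∀ t ∈ Icc 0 T, g t ≠ 0 := by
    intro t ht
    rw [hg t ht]
    exact neg_ne_zero.2 (mul_ne_zero hp (E.q_mem t ht).ne')
  have hsign : (∀ t ∈ Icc 0 T, 0 ≤ g t) ∨ ∀ t ∈ Icc 0 T, g t ≤ 0 := by
    rcases lt_or_gt_of_ne hp with h | h
    · left
      intro t ht
      rw [hg t ht]
      nlinarith [E.q_mem t ht]
    · right
      intro t ht
      rw [hg t ht]
      nlinarith [E.q_mem t ht]
  have hint := fun t ht => integral_one_div_of_hasDerivAt hf hcosh hg0 hsign (t := t) ht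
  -- The constants come from solving `-p₁ b = cosh η` and `k - p₁ a = sinh η` for `b` and `a`.
  refine ⟨?_, -1 / (p 0).1, k / (p 0).1, f, div_ne_zero (by norm_num) hp, fun t ht => ?_⟩
  · rintro ⟨G, S, -, hG, -, hST, hSpos, hS⟩
    have hne : (ae (volume.restrict S)).NeBot := by
      rw [ae_neBot]
      intro h
      rw [Measure.restrict_eq_zero] at h
      exact hSpos.ne' h
    have hall : ∀ᵐ t ∂volume.restrict S, t ∈ Icc 0 T ∧
        (∀ y ∈ G, pair (momentum (q t) (p t)) y = -1) := by
      filter_upwards [hS, ae_mono (Measure.restrict_mono hST le_rfl) (E.ae_natural hI hN),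
        ae_mono (Measure.restrict_mono hST le_rfl)
          (ae_restrict_mem (measurableSet_Icc (a := (0 : ℝ)) (b := T)))] with t h1 h2 h3
      refine ⟨h3, fun y hy => ?_⟩
      rw [← h1] at hy
      exact le_antisymm (h2.2.2 y hy.1) (h2.2.1 ▸ hy.2 _ h2.1)
    obtain ⟨t₀, ht₀, h₀⟩ := hall.exists
    -- Two distinct points of a line that misses the origin are independent, so their pairings with
    -- `h` determine `h`, hence the angle, and the integral formula recovers `t`. Thus `S` would be
    -- a single point up to a null set.
    have huniq : ∀ᵐ t ∂volume.restrict S, t = t₀ := by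
      filter_upwards [hall] with t ht
      obtain ⟨y, hy, z, hz, hyz⟩ := hG
      have hc : cross y z ≠ 0 := by
        intro hc
        apply hyz
        have e1 := h₀ y hy
        have e2 := h₀ z hz
        simp only [pair] at e1 e2
        simp only [cross] at hc
        ext
        · linear_combination y.1 * e2 - z.1 * e1 - (momentum (q t₀) (p t₀)).2 * hc
        · linear_combination y.2 * e2 - z.2 * e1 + (momentum (q t₀) (p t₀)).1 * hc
      have hm : momentum (q t) (p t) - momentum (q t₀) (p t₀) = 0 := by
        refine eq_zero_of_pair_eq_zero hc ?_ ?_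
        · have e1 := ht.2 y hy
          have e2 := h₀ y hy
          simp only [pair, Prod.fst_sub, Prod.snd_sub] at e1 e2 ⊢
          linarith
        · have e1 := ht.2 z hz
          have e2 := h₀ z hz
          simp only [pair, Prod.fst_sub, Prod.snd_sub] at e1 e2 ⊢
          linarith
      have hff : f t = f t₀ := by
        rw [(hfg t ht.1).2, (hfg t₀ ht₀).2, antipolarPoint, antipolarPoint, sub_eq_zero.1 hm]
      rw [(hint t ht.1).2, hff, ← (hint t₀ ht₀).2]
    have h0 : ∀ᵐ t ∂volume.restrict S, t ≠ t₀ := by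
      rw [ae_iff]
      simp only [not_not, ofPred_eq_eq_singleton]
      exact le_antisymm ((Measure.restrict_apply_le _ _).trans_eq Real.volume_singleton) bot_le
    obtain ⟨t, h1, h2⟩ := (huniq.and h0).exists
    exact h2 h1
  · have h1 := hbp t ht
    have h2 := hk t ht
    refine ⟨⟨_, hfr t ht, ((hfg t ht).2).symm⟩, ?_, ?_, ?_, ?_, ?_, hint t ht⟩
    · rw [coshO, sinhO, h1]
      simp [antipolarPoint]
    · rw [sinhO, h1, antipolarPoint, h2]
      field_simp
      ring
    · rw [coshO, h1, antipolarPoint, h2]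
      field_simp
    · rw [hcosh t ht]
      exact hg0 t ht
    · rw [hcosh t ht]
      exact (hf t).hasDerivWithinAt

/-- Extremals with vanishing first component of the momentum. -/
theorem IsExtremal.isTypeB (hI : PropI Ω) (E : IsExtremal Ω (-1) T q p u)
    (hN : IsNatural Ω T u) (hp : (p 0).1 = 0) : ∃ F, IsTypeB Ω T q p u F := by
  have hne := restrict_Icc_neBot E.T_pos
  obtain ⟨k, hk⟩ := E.exists_momentum_eq hI
  have hk' : ∀ t ∈ Icc 0 T, momentum (q t) (p t) = (0, k) := by
    intro t ht
    rw [hk t ht, hp, zero_mul, zero_mul, sub_zero]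
  have hu : ∀ᵐ t ∂volume.restrict (Icc 0 T), u t ∈ argmaxSet Ω (0, k) := by
    filter_upwards [E.ae_natural hI hN, ae_restrict_mem measurableSet_Icc] with t h1 h2
    rw [hk' t h2] at h1
    exact ⟨h1.1, fun z hz => h1.2.1 ▸ h1.2.2 z hz⟩
  -- A zero momentum contradicts `⟨h, u⟩ = -1`.
  have hk0 : k ≠ 0 := by
    rintro rfl
    obtain ⟨t, h1, h2⟩ := ((E.ae_natural hI hN).and (ae_restrict_mem measurableSet_Icc)).exists
    have h3 := h1.2.1
    rw [hk' t h2] at h3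
    simp [pair] at h3
  refine ⟨argmaxSet Ω (0, k), ⟨?_, (0, k), ?_, rfl, rfl⟩, hu, fun t ht => ?_⟩
  · obtain ⟨t, ht⟩ := hu.exists
    exact ⟨_, ht⟩
  · exact fun h => hk0 (congrArg Prod.snd h)
  · rw [hk' t ht]
    exact ⟨rfl, rfl⟩

/-! ### Lightlike extremals -/

/-- For `λ₀ = 0` the maximum condition gives `⟨p, u⟩ = 0`, which is the right-hand side of the
equation for `p₂`. -/
theorem IsExtremal.p_const_of_abnormal (hI : PropI Ω) (E : IsExtremal Ω 0 T q p u) {t : ℝ}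
    (ht : t ∈ Icc 0 T) : p t = p 0 := by
  have h0 : ∀ᵐ t ∂volume.restrict (Icc 0 T), HasDerivAt (fun s => (p s).2) 0 t := by
    filter_upwards [E.ae_extremalAt hI] with t h
    have h1 := h.2.pair_eq
    have h2 : (q t).2 * pair (p t) (u t) = 0 := by
      rw [zero_mul] at h1
      rw [← h1]
      simp only [pair, momentum]
      ring
    have h3 := h.2.deriv_p₂
    rw [(mul_eq_zero.1 h2).resolve_left (E.q_mem t h.1).ne', neg_zero] at h3
    exact h3
  exact Prod.ext (E.p₁_const hI ht)
    (eq_of_ae_hasDerivAt_zero E.T_pos.le (ac_snd E.T_pos.le E.p_lipschitz) h0 ht)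

/-- The control of an abnormal extremal stays on one boundary ray of the cone. -/
theorem IsExtremal.exists_ray (hI : PropI Ω) (F : Frame Ω l₀ l₁ v w)
    (hSS : PropStarStar Ω l₀ l₁) (E : IsExtremal Ω 0 T q p u) :
    ∃ x : ℝ × ℝ, x ≠ 0 ∧ (rayOf x = l₀ ∨ rayOf x = l₁) ∧
      ∀ᵐ t ∂volume.restrict (Icc 0 T), u t ∈ rayOf x := by
  have hp0 : p 0 ≠ 0 := by
    intro h
    exact E.nontrivial 0 ⟨le_rfl, E.T_pos.le⟩ (by rw [h]; rfl)
  have hfr : ∀ᵐ t ∂volume.restrict (Icc 0 T),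
      (u t ∈ l₀ ∨ u t ∈ l₁) ∧ u t ≠ 0 ∧ pair (p 0) (u t) = 0 := by
    filter_upwards [E.ae_extremalAt hI] with t ht
    have h1 := ht.2.mem_frontier F hSS (E.momentum_ne_zero ht.1)
    rw [hSS.frontier_cone] at h1
    refine ⟨h1, ht.2.ne_zero, ?_⟩
    have h2 := ht.2.pair_eq
    rw [zero_mul, E.p_const_of_abnormal hI ht.1] at h2
    have h3 : (q t).2 * pair (p 0) (u t) = 0 := by
      simp only [pair, momentum] at h2 ⊢
      linarith
    exact (mul_eq_zero.1 h3).resolve_left (E.q_mem t ht.1).ne'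
  have key : ∀ x y : ℝ × ℝ, x ∈ rayOf y → x ≠ 0 → pair (p 0) x = 0 → pair (p 0) y = 0 := by
    rintro _ y ⟨s, hs, rfl⟩ h0 h1
    rw [pair_smul] at h1
    refine (mul_eq_zero.1 h1).resolve_left ?_
    rintro rfl
    exact h0 (zero_smul _ _)
  have hv : v ≠ 0 := by
    rintro rfl
    exact F.cross_ne (by simp [cross])
  have hw : w ≠ 0 := by
    rintro rfl
    exact F.cross_ne (by simp [cross])
  -- The constant covector `p 0` annihilates the control and, being non-zero, at most one of the
  -- independent vectors `v`, `w`. This prevents switching between the rays.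
  by_cases h : pair (p 0) v = 0
  · refine ⟨v, hv, Or.inl F.ray₀.symm, ?_⟩
    filter_upwards [hfr] with t ht
    rcases ht.1 with h1 | h1
    · rwa [F.ray₀] at h1
    · rw [F.ray₁] at h1
      exact absurd (eq_zero_of_pair_eq_zero F.cross_ne h (key _ _ h1 ht.2.1 ht.2.2)) hp0
  · refine ⟨w, hw, Or.inr F.ray₁.symm, ?_⟩
    filter_upwards [hfr] with t ht
    rcases ht.1 with h1 | h1
    · rw [F.ray₀] at h1
      exact absurd (key _ _ h1 ht.2.1 ht.2.2) h
    · rwa [F.ray₁] at h1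

/-- A curve whose control stays on a ray moves monotonically along this ray. -/
theorem IsExtremal.exists_path (hI : PropI Ω) (E : IsExtremal Ω lam T q p u) {x : ℝ × ℝ}
    (hx : x ≠ 0) (hu : ∀ᵐ t ∂volume.restrict (Icc 0 T), u t ∈ rayOf x) :
    ∃ s : ℝ → ℝ, ContinuousOn s (Icc 0 T) ∧ s 0 = 0 ∧ MonotoneOn s (Icc 0 T) ∧ 0 < s T ∧
      ∀ t ∈ Icc 0 T, q t = q 0 + s t • x := by
  have hT := E.T_pos
  have hne := restrict_Icc_neBot hT
  have hxx : 0 < pair x x := by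
    have h1 : 0 ≤ pair x x := by
      unfold pair
      nlinarith [mul_self_nonneg x.1, mul_self_nonneg x.2]
    refine lt_of_le_of_ne h1 fun h => hx ?_
    unfold pair at h
    exact Prod.ext (by nlinarith [mul_self_nonneg x.1, mul_self_nonneg x.2] : x.1 = 0)
      (by nlinarith [mul_self_nonneg x.1, mul_self_nonneg x.2] : x.2 = 0)
  have hac₁ := ac_fst hT.le E.q_lipschitz
  have hac₂ := ac_snd hT.le E.q_lipschitz
  -- The coordinate of `q` along `x`; the transversal coordinate `cross x (q t)` is conserved.
  set S : ℝ → ℝ := fun t => (x.1 / pair x x) * (q t).1 + (x.2 / pair x x) * (q t).2 with hS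
  have hSac : AbsolutelyContinuousOnInterval S 0 T :=
    (hac₁.const_mul _).fun_add (hac₂.const_mul _)
  have hSd : ∀ᵐ t ∂volume.restrict (Icc 0 T), ∃ d : ℝ, 0 < d ∧ HasDerivAt S d t := by
    filter_upwards [hu, E.ae_extremalAt hI] with t h1 h2
    obtain ⟨k, hk, huk⟩ := h1
    have hk0 : k ≠ 0 := by
      rintro rfl
      exact h2.2.ne_zero (by rw [huk, zero_smul])
    have hkp : 0 < k := lt_of_le_of_ne hk hk0.symm
    refine ⟨(q t).2 * k, mul_pos (E.q_mem t h2.1) hkp, ?_⟩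
    have h3 := (h2.2.deriv_a.const_mul (x.1 / pair x x)).add
      (h2.2.deriv_b.const_mul (x.2 / pair x x))
    have h4 : x.1 / pair x x * ((q t).2 * (u t).1) + x.2 / pair x x * ((q t).2 * (u t).2) =
        (q t).2 * k := by
      rw [huk]
      simp only [Prod.smul_fst, Prod.smul_snd, smul_eq_mul]
      field_simp
      unfold pair
      ring
    rw [h4] at h3
    exact h3
  have hmono : MonotoneOn S (Icc 0 T) := by
    intro a ha b hb hab
    have hsub : uIcc a b ⊆ uIcc 0 T := by
      rw [uIcc_of_le hab, uIcc_of_le hT.le]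
      exact Icc_subset_Icc ha.1 hb.2
    have h1 := (hSac.mono hsub).integral_deriv_eq_sub
    have h2 : 0 ≤ ∫ t in a..b, deriv S t := by
      refine intervalIntegral.integral_nonneg_of_ae_restrict hab ?_
      have h3 : ∀ᵐ t ∂volume.restrict (Icc a b), ∃ d : ℝ, 0 < d ∧ HasDerivAt S d t :=
        ae_mono (Measure.restrict_mono (Icc_subset_Icc ha.1 hb.2) le_rfl) hSd
      filter_upwards [h3] with t ht
      obtain ⟨d, hd, hd'⟩ := ht
      rw [hd'.deriv]
      exact hd.le
    linarith
  have hcr : ∀ t ∈ Icc 0 T, cross x (q t) = cross x (q 0) := by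
    intro t ht
    have hac : AbsolutelyContinuousOnInterval (fun t => cross x (q t)) 0 T :=
      (hac₂.const_mul x.1).fun_sub (hac₁.const_mul x.2)
    refine eq_of_ae_hasDerivAt_zero hT.le hac ?_ ht
    filter_upwards [hu, E.ae_extremalAt hI] with t h1 h2
    obtain ⟨k, hk, huk⟩ := h1
    have h3 := (h2.2.deriv_b.const_mul x.1).sub (h2.2.deriv_a.const_mul x.2)
    have h4 : x.1 * ((q t).2 * (u t).2) - x.2 * ((q t).2 * (u t).1) = 0 := by
      rw [huk]
      simp only [Prod.smul_fst, Prod.smul_snd, smul_eq_mul]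
      ring
    rw [h4] at h3
    exact h3
  have h0T : (0 : ℝ) ∈ Icc 0 T := ⟨le_rfl, hT.le⟩
  have hTT : T ∈ Icc 0 T := ⟨hT.le, le_rfl⟩
  have hcont : ContinuousOn S (Icc 0 T) := by
    have := hSac.continuousOn
    rwa [uIcc_of_le hT.le] at this
  refine ⟨fun t => S t - S 0, hcont.sub continuousOn_const, sub_self _,
    fun a ha b hb hab => sub_le_sub_right (hmono ha hb hab) _, ?_, fun t ht => ?_⟩
  -- Otherwise the monotone function `S` is constant, against its positive derivative at almost
  -- every time.
  · by_contra hle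
    have hIoo : ∀ᵐ t ∂volume.restrict (Icc 0 T), t ∈ Ioo 0 T := by
      rw [← restrict_Ioo_eq_restrict_Icc]
      exact ae_restrict_mem measurableSet_Ioo
    obtain ⟨t, ⟨d, hd, hd'⟩, ht⟩ := (hSd.and hIoo).exists
    have hconst : S =ᶠ[𝓝 t] fun _ => S 0 := by
      filter_upwards [isOpen_Ioo.mem_nhds ht] with r hr
      have hr' : r ∈ Icc 0 T := ⟨hr.1.le, hr.2.le⟩
      have h1 := hmono h0T hr' hr'.1
      have h2 := hmono hr' hTT hr'.2
      linarith
    have h1 := hd'.unique ((hasDerivAt_const t (S 0)).congr_of_eventuallyEq hconst)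
    exact hd.ne' h1
  · have h1 := hcr t ht
    unfold cross at h1
    ext
    · simp only [hS, Prod.fst_add, Prod.smul_fst, smul_eq_mul]
      field_simp
      unfold pair
      linear_combination -x.2 * h1
    · simp only [hS, Prod.snd_add, Prod.smul_snd, smul_eq_mul]
      field_simp
      unfold pair
      linear_combination x.1 * h1

/-- Every initial segment of a light ray is the image of a lightlike extremal. -/
theorem Frame.exists_extremal (hI : PropI Ω) (hS : PropStar Ω) (F : Frame Ω l₀ l₁ v w)
    (hSS : PropStarStar Ω l₀ l₁) {P : ℝ × ℝ} (hP : P ∈ lightRay l₀) (hne : P ≠ affOne) :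
    ∃ (lam T : ℝ) (q p u : ℝ → ℝ × ℝ), IsExtremal Ω lam T q p u ∧
      IsLightlike Ω T u ∧ q 0 = affOne ∧ q '' Icc 0 T = segment ℝ affOne P := by
  obtain ⟨hP2, y, hy, rfl⟩ := hP
  have hy0 : y ≠ 0 := by
    rintro rfl
    exact hne (add_zero _)
  have hyf : y ∈ frontier (cone Ω) := (ray_subset_frontier hSS).1 hy
  have hyC : y ∈ cone Ω := PropI.isClosed_cone.frontier_subset hyf
  -- An affine function that is positive at both end points.
  have hb : ∀ t ∈ Icc (0 : ℝ) 1, 0 < 1 + t * y.2 := by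
    intro t ht
    have h1 : 0 < 1 + y.2 := hP2
    nlinarith [ht.1, ht.2, mul_nonneg ht.1 h1.le]
  -- The constant costate: it annihilates `v`, and the factor `-cross v w` makes it negative on `w`
  -- whatever the orientation of the frame.
  set c : ℝ × ℝ := (-cross v w) • (-v.2, v.1) with hc
  have hcv : pair c v = 0 := by simp [hc, pair]; ring
  have hcw : pair c w < 0 := by
    have : pair c w = -(cross v w * cross v w) := by simp [hc, pair, cross]; ring
    rw [this]
    exact neg_neg_of_pos (mul_self_pos.2 F.cross_ne)
  have hc0 : c ≠ 0 := by
    intro h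
    rw [h] at hcw
    simp [pair] at hcw
  have hcy : pair c y = 0 := by
    have h1 := hy
    rw [F.ray₀] at h1
    obtain ⟨s, -, rfl⟩ := h1
    rw [pair_smul, hcv, mul_zero]
  have hcC : ∀ z ∈ cone Ω, pair c z ≤ 0 := by
    intro z hz
    rw [F.cone_eq] at hz
    obtain ⟨s, r, hs, hr, rfl⟩ := hz
    rw [pair_add, pair_smul, pair_smul, hcv]
    nlinarith
  have hq2 : ∀ t : ℝ, (affOne + t • y).2 = 1 + t * y.2 := by
    intro t
    simp [affOne]
  have hu : ∀ t ∈ Icc (0 : ℝ) 1, (1 + t * y.2)⁻¹ • y ∈ frontier (cone Ω) ∧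
      (1 + t * y.2)⁻¹ • y ≠ 0 := fun t ht =>
    ⟨frontier_cone_smul hSS hyf (inv_nonneg.2 (hb t ht).le),
      smul_ne_zero (inv_ne_zero (hb t ht).ne') hy0⟩
  have hmem := ae_restrict_mem (μ := (volume : Measure ℝ)) (measurableSet_Icc (a := (0 : ℝ))
    (b := 1))
  -- The control is divided by `b = 1 + t y₂`, so that `q' = b u = y` and the segment is traversed
  -- at constant velocity.
  refine ⟨0, 1, fun t => affOne + t • y, fun _ => c, fun t => (1 + t * y.2)⁻¹ • y, ?_, ?_, ?_, ?_⟩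
  · refine
      { T_pos := one_pos
        lam_mem := Or.inl rfl
        q_lipschitz := ⟨‖y‖₊, LipschitzOnWith.of_dist_le_mul fun s _ t _ => ?_⟩
        p_lipschitz := ⟨0, (LipschitzWith.const c).lipschitzOnWith⟩
        q_mem := fun t ht => by rw [hq2]; exact hb t ht
        u_measurable := ?_
        u_mem := ?_
        u_ne_zero := ?_
        nontrivial := fun t _ h => hc0 (congrArg Prod.snd h)
        q_eq := ?_
        p_eq := ?_
        maximum := ?_ }
    · rw [dist_add_left, dist_eq_norm, ← sub_smul, norm_smul, Real.dist_eq, Real.norm_eq_abs,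
        mul_comm]
      rfl
    · exact (Measurable.smul_const (by fun_prop) y).aemeasurable
    · filter_upwards [hmem] with t ht
      exact PropI.cone_smul hyC (inv_nonneg.2 (hb t ht).le)
    · filter_upwards [hmem] with t ht
      exact (hu t ht).2
    · filter_upwards [hmem] with t ht
      rw [gradP_eq, hq2]
      have h1 : ((1 + t * y.2) * ((1 + t * y.2)⁻¹ • y).1, (1 + t * y.2) *
          ((1 + t * y.2)⁻¹ • y).2) = y := by
        have := (hb t ht).ne'
        ext
        · simp only [Prod.smul_fst, smul_eq_mul]; field_simp
        · simp only [Prod.smul_snd, smul_eq_mul]; field_simp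
      rw [h1]
      simpa using ((hasDerivAt_id t).smul_const y).const_add affOne
    · filter_upwards with t
      rw [gradQ_eq, pair_smul, hcy, mul_zero, Prod.mk_zero_zero, neg_zero]
      exact hasDerivAt_const t c
    · filter_upwards [hmem] with t ht z hz
      have hmo : momentum (affOne + t • y) c = (1 + t * y.2) • c := by
        unfold momentum
        rw [hq2]
        rfl
      rw [pontryagin_eq, pontryagin_eq, zero_mul, zero_mul, sub_zero, sub_zero, hmo, pair_smul _ y,
        smul_pair c y, hcy, mul_zero, mul_zero, smul_pair c z]
      have := hb t ht
      nlinarith [hcC z hz]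
  · filter_upwards [hmem] with t ht
    exact nu_eq_zero_of_mem_frontier hI hS hSS (hu t ht).1 (hu t ht).2
  · simp
  · rw [segment_eq_image']
    simp

/-- The image of a lightlike extremal issuing from the unit element is a segment of a light ray. -/
theorem IsExtremal.image_eq_segment (hI : PropI Ω) (E : IsExtremal Ω lam T q p u)
    {x : ℝ × ℝ} (hx : x ≠ 0) (hu : ∀ᵐ t ∂volume.restrict (Icc 0 T), u t ∈ rayOf x)
    (hq : q 0 = affOne) :
    ∃ P ∈ lightRay (rayOf x), P ≠ affOne ∧ q '' Icc 0 T = segment ℝ affOne P := by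
  obtain ⟨s, hsc, hs0, hsm, hsT, hqs⟩ := E.exists_path hI hx hu
  have hT := E.T_pos
  have h0T : (0 : ℝ) ∈ Icc 0 T := ⟨le_rfl, hT.le⟩
  have hTT : T ∈ Icc 0 T := ⟨hT.le, le_rfl⟩
  rw [hq] at hqs
  refine ⟨q T, ⟨E.q_mem T hTT, s T • x, ⟨s T, hsT.le, rfl⟩, hqs T hTT⟩, ?_, ?_⟩
  · rw [hqs T hTT]
    intro h
    exact smul_ne_zero hsT.ne' hx (by simpa using h)
  · rw [segment_eq_image']
    ext z
    constructor
    · rintro ⟨t, ht, rfl⟩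
      have h1 := hsm h0T ht ht.1
      have h2 := hsm ht hTT ht.2
      rw [hs0] at h1
      refine ⟨s t / s T, ⟨div_nonneg h1 hsT.le, (div_le_one hsT).2 h2⟩, ?_⟩
      rw [hqs T hTT, hqs t ht]
      simp only [add_sub_cancel_left]
      rw [smul_smul, div_mul_cancel₀ _ hsT.ne']
    · rintro ⟨θ, hθ, rfl⟩
      have h1 : θ * s T ∈ Icc (s 0) (s T) := by
        rw [hs0]
        exact ⟨mul_nonneg hθ.1 hsT.le, by nlinarith [hθ.2]⟩
      obtain ⟨t, ht, hst⟩ := intermediate_value_Icc hT.le hsc h1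
      refine ⟨t, ht, ?_⟩
      rw [hqs T hTT, hqs t ht, hst]
      simp only [add_sub_cancel_left]
      rw [smul_smul]

theorem Frame.lightRay_inter (F : Frame Ω l₀ l₁ v w) : lightRay l₀ ∩ lightRay l₁ = {affOne} := by
  ext P
  rw [mem_singleton_iff]
  constructor
  · rintro ⟨⟨-, y, hy, rfl⟩, -, z, hz, h⟩
    have hyz : y = z := add_left_cancel h
    have h0 : y ∈ l₀ ∩ l₁ := ⟨hy, hyz ▸ hz⟩
    rw [F.inter_eq, mem_singleton_iff] at h0
    rw [h0, add_zero]
  · rintro rfl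
    have h0 : (0 : ℝ × ℝ) ∈ l₀ ∩ l₁ := by rw [F.inter_eq]; rfl
    exact ⟨⟨one_pos, 0, h0.1, (add_zero _).symm⟩, ⟨one_pos, 0, h0.2, (add_zero _).symm⟩⟩

end LorentzAff

/-! ### The theorem assembled. -/

theorem theorem7 (Ω l₀ l₁ : Set (ℝ × ℝ)) (hI : LorentzAff.PropI Ω)
    (hS : LorentzAff.PropStar Ω) (hSS : LorentzAff.PropStarStar Ω l₀ l₁)
    (ω₀ : ℝ × ℝ) (hω₀ : ω₀ ∈ frontier (LorentzAff.antipolar Ω)) :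
    -- every extremal is either normal timelike or abnormal lightlike
    (∀ (lam T : ℝ) (q p u : ℝ → ℝ × ℝ), LorentzAff.IsExtremal Ω lam T q p u →
      (lam = -1 ∧ LorentzAff.IsTimelike Ω T u ∧ ¬ LorentzAff.IsLightlike Ω T u) ∨
      (lam = 0 ∧ LorentzAff.IsLightlike Ω T u ∧ ¬ LorentzAff.IsTimelike Ω T u)) ∧
    -- timelike extremals in natural parametrisation
    (∀ (lam T : ℝ) (q p u : ℝ → ℝ × ℝ), LorentzAff.IsExtremal Ω lam T q p u →
      LorentzAff.IsTimelike Ω T u → LorentzAff.IsNatural Ω T u →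
      (LorentzAff.IsTypeA Ω ω₀ T q p ∨ ∃ F, LorentzAff.IsTypeB Ω T q p u F) ∧
      (∀ F, LorentzAff.IsHorizontalFacet Ω F →
        (∀ᵐ t ∂volume.restrict (Icc 0 T), u t ∈ F) →
        ∃ c₃ c₄ : ℝ, 0 < c₃ ∧ (∀ ω ∈ F, ω.2 = c₄) ∧
          ∀ t ∈ Icc 0 T, (q t).2 = c₃ * Real.exp (c₄ * t))) ∧
    -- there is at most one facet with a horizontal supporting line
    (∀ F F' : Set (ℝ × ℝ), LorentzAff.IsHorizontalFacet Ω F →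
      LorentzAff.IsHorizontalFacet Ω F' → F = F') ∧
    -- lightlike extremals
    (∀ (lam T : ℝ) (q p u : ℝ → ℝ × ℝ), LorentzAff.IsExtremal Ω lam T q p u →
      LorentzAff.IsLightlike Ω T u →
      lam = 0 ∧
      (∃ l, (l = l₀ ∨ l = l₁) ∧ (∀ᵐ t ∂volume.restrict (Icc 0 T), u t ∈ l) ∧
        ∀ t ∈ Icc 0 T, q t - q 0 ∈ l) ∧
      ∫ t in (0 : ℝ)..T, LorentzAff.nu Ω (u t) = 0) ∧
    -- the lightlike trajectories issuing from the unit element are the initial segments of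
    -- exactly two lines
    (∀ γ : Set (ℝ × ℝ),
      (∃ (lam T : ℝ) (q p u : ℝ → ℝ × ℝ), LorentzAff.IsExtremal Ω lam T q p u ∧
        LorentzAff.IsLightlike Ω T u ∧ q 0 = LorentzAff.affOne ∧ q '' Icc 0 T = γ) ↔
      ∃ P ∈ LorentzAff.lightRay l₀ ∪ LorentzAff.lightRay l₁,
        P ≠ LorentzAff.affOne ∧ γ = segment ℝ LorentzAff.affOne P) ∧
    LorentzAff.lightRay l₀ ∩ LorentzAff.lightRay l₁ = {LorentzAff.affOne} ∧ l₀ ≠ l₁ := by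

  obtain ⟨v, w, F⟩ := LorentzAff.exists_frame hI hS hSS
  have hSS' : LorentzAff.PropStarStar Ω l₁ l₀ :=
    ⟨hSS.ray₁, hSS.ray₀, by rw [hSS.frontier_cone, union_comm], hSS.dist₁, hSS.dist₀⟩
  refine ⟨fun lam T q p u E => E.timelike_or_lightlike hI hS hSS, ?_,
    fun G G' hG hG' => LorentzAff.horizontalFacet_unique hI hS hG hG', ?_, ?_,
    F.lightRay_inter, F.ray_ne⟩
  · intro lam T q p u E hu hN
    obtain rfl := E.lam_eq_of_timelike hI hS hSS hu
    refine ⟨?_, fun G hG hG' => E.exp_of_mem_horizontalFacet hI hG hG'⟩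
    -- Since `p₁` is constant and `b > 0`, the component `h₁ = p₁ b` vanishes identically or
    -- nowhere.
    by_cases hp : (p 0).1 = 0
    · exact Or.inr (E.isTypeB hI hN hp)
    · exact Or.inl (E.isTypeA hI F hSS hN hω₀ hp)
  · intro lam T q p u E hL
    obtain rfl := E.lam_eq_of_lightlike hI hS hSS hL
    obtain ⟨x, hx, hl, hu⟩ := E.exists_ray hI F hSS
    obtain ⟨s, -, hs0, hsm, -, hqs⟩ := E.exists_path hI hx hu
    refine ⟨rfl, ⟨LorentzAff.rayOf x, hl, hu, fun t ht => ?_⟩, ?_⟩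
    · have h1 := hsm ⟨le_rfl, E.T_pos.le⟩ ht ht.1
      rw [hs0] at h1
      exact ⟨s t, h1, by rw [hqs t ht, add_sub_cancel_left]⟩
    · rw [intervalIntegral.integral_of_le E.T_pos.le, ← integral_Icc_eq_integral_Ioc]
      refine integral_eq_zero_of_ae ?_
      filter_upwards [hL] with t ht
      simp [LorentzAff.nu, ht]
  · intro γ
    constructor
    · rintro ⟨lam, T, q, p, u, E, hL, hq, rfl⟩
      obtain rfl := E.lam_eq_of_lightlike hI hS hSS hL
      obtain ⟨x, hx, hl, hu⟩ := E.exists_ray hI F hSS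
      obtain ⟨P, hP, hne, him⟩ := E.image_eq_segment hI hx hu hq
      refine ⟨P, ?_, hne, him⟩
      rcases hl with hl | hl <;> rw [hl] at hP
      · exact Or.inl hP
      · exact Or.inr hP
    · rintro ⟨P, hP | hP, hne, rfl⟩
      · exact F.exists_extremal hI hS hSS hP hne
      · exact F.symm.exists_extremal hI hS hSS' hP hne
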